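/- Let $T$ be a complete $\omega$-categorical first-order theory in a countable language, let $\kappa$ be an infinite cardinal, and let $\mathcal M\models T$ be $\kappa$-saturated with universe $M$. The universe of $\mathcal M^{eq}$ consists of the elements of $M$ and, for every $k\ge 1$ and every $\emptyset$-definable equivalence relation $E$ on $M^k$, the $E$-classes; $\mathcal M^{eq}$ carries the structure of $\mathcal M$ on $M$, a predicate for each sort, and the projections $M^k\to M^k/E$. Write $\mathrm{acl}^{eq}$ and $\mathrm{tp}$ for algebraic closure and complete type computed in $\mathcal M^{eq}$. For $n<\omega$ let $M_n\subseteq M^{eq}$ be the set consisting of $M$ and all classes of $\emptyset$-definable equivalence relations on $M^k$ with $1\le k\le n$, and let $\mathrm{acl}^n(A)=\mathrm{acl}^{eq}(A)\cap M_n$. All subsets of $M^{eq}$ below that serve as parameter sets (that is, $A,B,C,D$) have cardinality less than $\kappa$. For $A,B\subseteq M^{eq}$ the $n$-rank $\mathrm{rk}^n(A/B)$ is defined by: $\mathrm{rk}^n(A/B)\ge 0$ always; $\mathrm{rk}^n(A/B)\ge\alpha+1$ iff there is $a\in\mathrm{acl}^n(A)\setminus\mathrm{acl}^n(B)$ with $\mathrm{rk}^n(A/\{a\}\cup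 B)\ge\alpha$; for limit $\alpha$, $\mathrm{rk}^n(A/B)\ge\alpha$ iff $\mathrm{rk}^n(A/B)\ge\beta$ for all $\beta<\alpha$; and $\mathrm{rk}^n(A/B)=\alpha$ iff $\mathrm{rk}^n(A/B)\ge\alpha$ and $\mathrm{rk}^n(A/B)\not\ge\alpha+1$ (it is undefined if $\mathrm{rk}^n(A/B)\ge\alpha$ for all ordinals $\alpha$). Say that $A$ is $n$-independent from $B$ over $C$, written $A\perp^n_C B$, if $\mathrm{rk}^n(A'/B\cup C)=\mathrm{rk}^n(A'/C)$ for every finite $A'\subseteq A$. A function $\sigma$ from a subset $D$ of $M^{eq}$ (of any cardinality) bijectively onto a subset of $M^{eq}$ is called elementary if $\mathrm{tp}(a_1,\dots,a_m)=\mathrm{tp}(\sigma(a_1),\dots,\sigma(a_m))$ for all $m<\omega$ and $a_1,\dots,a_m\in D$. Theorem. Fix $n<\omega$ and assume the exchange property with respect to $n$: whenever $C\subseteq M^{eq}$, $2\le k<\omega$, $a_1,\dots,a_k\in M_n$, $\mathrm{rk}^n(a_i/C)=1$ for $i=1,\dots,k$, and $a_k\in\mathrm{acl}^{eq}(\{a_1,\dots,a_{k-1}\}\cup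 C)\setminus\mathrm{acl}^{eq}(\{a_2,\dots,a_{k-1}\}\cup C)$, then $a_1\in\mathrm{acl}^{eq}(\{a_2,\dots,a_k\}\cup C)$. Then $\perp^n$ is an independence relation restricted to $M_n$, that is, the following hold for all $A,B,C,D\subseteq M_n$ with $A$ finite. 1. (Invariance) If $\sigma$ is an elementary function whose domain includes $A\cup B\cup C$, then $A\perp^n_C B$ if and only if $\sigma(A)\perp^n_{\sigma(C)}\sigma(B)$. 2. (Local character) There is a countable $C\subseteq B$ such that $A\perp^n_C B$. 3. (Finite character) $A\perp^n_C B$ if and only if $A\perp^n_C B'$ for all finite $B'\subseteq B$. 4. (Extension) If $C\subseteq B$ and $A=\{a_1,\dots,a_m\}$, then there is $A'=\{a_1',\dots,a_m'\}\subseteq M^{eq}$ such that $\mathrm{tp}(a_1',\dots,a_m'/C)=\mathrm{tp}(a_1,\dots,a_m/C)$ and $A'\perp^n_C B$. 5. (Monotonicity) If $B\subseteq C\subseteq D$ and $A\perp^n_B D$, then $A\perp^n_B C$ and $A\perp^n_C D$. 6. (Transitivity) If $B\subseteq C\subseteq D$, $A\perp^n_B C$ and $A\perp^n_C D$, then $A\perp^n_B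 D$. 7. (Symmetry) If $B$ is also finite, then $A\perp^n_C B$ if and only if $B\perp^n_C A$. -/

import Mathlib

open FirstOrder Cardinal

universe u v w

namespace NIndep

/-! ### The structure of imaginary elements -/

/-- A `∅`-definable equivalence relation on `M ^ k`. -/
structure DefEquiv (L : FirstOrder.Language.{u, v}) (M : Type w) [L.Structure M] (k : ℕ) where
  /-- The equivalence relation. -/
  rel : Setoid (Fin k → M)
  definable : (∅ : Set M).Definable L
    {x : Fin k ⊕ Fin k → M | rel.r (fun i => x (Sum.inl i)) (fun i => x (Sum.inr i))}

/-- The universe of `M^eq`: the real elements, that is, the elements of `M`, together with, for every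
`k ≥ 1` and every `∅`-definable equivalence relation `E` on `M ^ k`, the equivalence classes of `E`
(the imaginary elements of sort `E`). In `imag k E q` the relation `E` lives on `M ^ (k + 1)`. -/
inductive Meq (L : FirstOrder.Language.{u, v}) (M : Type w) [L.Structure M] : Type w
  | real (y : M) : Meq L M
  | imag (k : ℕ) (E : DefEquiv L M (k + 1)) (q : Quotient E.rel) : Meq L M

/-- The relation symbols of the vocabulary of `M^eq`: the relation symbols of `L`, the graphs of the
function symbols of `L` (which are partial functions on `M^eq`), a predicate for every sort, and the
graph of the projection `M ^ (k + 1) → M ^ (k + 1) / E` for every sort of imaginary elements. -/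
inductive EqRel (L : FirstOrder.Language.{u, v}) (M : Type w) [L.Structure M] : ℕ → Type (max u v w)
  | rel {k : ℕ} (R : L.Relations k) : EqRel L M k
  | graph {k : ℕ} (f : L.Functions k) : EqRel L M (k + 1)
  | homeSort : EqRel L M 1
  | sort (k : ℕ) (E : DefEquiv L M (k + 1)) : EqRel L M 1
  | proj (k : ℕ) (E : DefEquiv L M (k + 1)) : EqRel L M (k + 1 + 1)

/-- The vocabulary of `M^eq`. -/
def eqLang (L : FirstOrder.Language.{u, v}) (M : Type w) [L.Structure M] : FirstOrder.Language.{0, max u v w} where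
  Functions := fun _ => Empty
  Relations := EqRel L M

/-- The interpretation in `M^eq` of the relation symbols of its vocabulary. -/
def eqRelMap (L : FirstOrder.Language.{u, v}) (M : Type w) [L.Structure M] :
    {m : ℕ} → EqRel L M m → (Fin m → Meq L M) → Prop
  | _, .rel R, x => ∃ y, x = (fun i => Meq.real (y i)) ∧ Language.Structure.RelMap R y
  | _, .graph f, x => ∃ y, x = Fin.snoc (α := fun _ => Meq L M) (fun i => Meq.real (y i))
      (Meq.real (Language.Structure.funMap f y))
  | _, .homeSort, x => ∃ y, x 0 = Meq.real y
  | _, .sort k E, x => ∃ q, x 0 = Meq.imag k E q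
  | _, .proj k E, x => ∃ y : Fin (k + 1) → M, x = Fin.snoc (α := fun _ => Meq L M)
      (fun i => Meq.real (y i)) (Meq.imag k E (Quotient.mk E.rel y))

/-- The structure `M^eq`. -/
instance eqStructure (L : FirstOrder.Language.{u, v}) (M : Type w) [L.Structure M] :
    (eqLang L M).Structure (Meq L M) where
  funMap := fun f _ => f.elim
  RelMap := fun R x => eqRelMap L M R x

/-- The set `M_n`: `M_0 = M`, and `M_{n+1}` is obtained from `M_n` by adding every equivalence class
of every `∅`-definable equivalence relation on `M ^ (n + 1)`. -/
def level (L : FirstOrder.Language.{u, v}) (M : Type w) [L.Structure M] : ℕ → Set (Meq L M)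
  | 0 => Set.range Meq.real
  | n + 1 => level L M n ∪ {a | ∃ E q, a = Meq.imag n E q}

section

variable {L : FirstOrder.Language.{u, v}} {M : Type w} [L.Structure M]

/-- The algebraic closure `acl^eq(A)` computed in `M^eq`: the union of all finite subsets of `M^eq`
that are definable in `M^eq` with parameters from `A`. -/
def aclEq (A : Set (Meq L M)) : Set (Meq L M) :=
  {a | ∃ D : Set (Meq L M), A.Definable₁ (eqLang L M) D ∧ D.Finite ∧ a ∈ D}

/-- `acl^n(A) = acl^eq(A) ∩ M_n`. -/
def acl (n : ℕ) (A : Set (Meq L M)) : Set (Meq L M) := aclEq A ∩ level L M n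

/-- The complete type `tp(a_1, …, a_m / C)` computed in `M^eq`. -/
def tp (C : Set (Meq L M)) {m : ℕ} (a : Fin m → Meq L M) : Set ((eqLang L M)[[C]].Formula (Fin m)) :=
  {φ | φ.Realize a}

/-- `σ` restricted to `D` is an elementary function from `D` onto its image in `M^eq`. -/
def IsElementaryOn (σ : Meq L M → Meq L M) (D : Set (Meq L M)) : Prop :=
  Set.InjOn σ D ∧
    ∀ (m : ℕ) (a : Fin m → Meq L M), (∀ i, a i ∈ D) → tp ∅ a = tp ∅ (fun i => σ (a i))

/-! ### The `n`-rank and `n`-independence -/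

/-- `RankGE n A B α` says that `rk^n(A / B) ≥ α`. -/
inductive RankGE (n : ℕ) (A : Set (Meq L M)) : Set (Meq L M) → Ordinal.{w} → Prop
  | zero (B : Set (Meq L M)) : RankGE n A B 0
  | succ (B : Set (Meq L M)) (α : Ordinal.{w}) (a : Meq L M) (ha : a ∈ acl n A \ acl n B)
      (h : RankGE n A ({a} ∪ B) α) : RankGE n A B (Order.succ α)
  | limit (B : Set (Meq L M)) (α : Ordinal.{w}) (hα : Order.IsSuccLimit α)
      (h : ∀ β < α, RankGE n A B β) : RankGE n A B α

/-- `HasRank n A B α` says that `rk^n(A / B) ≥ α` and not `rk^n(A / B) ≥ α + 1`; there is at most one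
such `α`, see `HasRank.unique`. -/
def HasRank (n : ℕ) (A B : Set (Meq L M)) (α : Ordinal.{w}) : Prop :=
  RankGE n A B α ∧ ¬ RankGE n A B (Order.succ α)

open Classical in
/-- The `n`-rank `rk^n(A / B)`, with the value `⊤` if it is undefined, that is, if
`rk^n(A / B) ≥ α` for all ordinals `α`. -/
noncomputable def rank (n : ℕ) (A B : Set (Meq L M)) : WithTop Ordinal.{w} :=
  if h : ∃ α, HasRank n A B α then ((h.choose : Ordinal.{w}) : WithTop Ordinal.{w}) else ⊤

theorem acl_mono (n : ℕ) {B C : Set (Meq L M)} (h : B ⊆ C) : acl n B ⊆ acl n C := by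
  rintro a ⟨⟨D, hD, hf, ha⟩, hn⟩
  exact ⟨⟨D, Set.Definable.mono hD h, hf, ha⟩, hn⟩

theorem RankGE.mono {n : ℕ} {A C : Set (Meq L M)} {α : Ordinal.{w}} (h : RankGE n A C α) :
    ∀ {B : Set (Meq L M)}, B ⊆ C → RankGE n A B α := by
  induction h with
  | zero C => intro B _; exact .zero B
  | succ C α a ha _ ih =>
    intro B hB
    exact .succ B α a ⟨ha.1, fun h => ha.2 (acl_mono n hB h)⟩ (ih (Set.union_subset_union_right _ hB))
  | limit C α hα _ ih => intro B hB; exact .limit B α hα fun β hβ => ih β hβ hB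

theorem RankGE.of_le {n : ℕ} {A B : Set (Meq L M)} {α β : Ordinal.{w}} (h : RankGE n A B α)
    (hβ : β ≤ α) : RankGE n A B β := by
  induction h generalizing β with
  | zero B =>
    obtain rfl : β = 0 := le_antisymm hβ (zero_le)
    exact .zero B
  | succ B α a ha h ih =>
    rcases hβ.lt_or_eq with hlt | rfl
    · exact (ih (Order.lt_succ_iff.1 hlt)).mono Set.subset_union_right
    · exact .succ B α a ha h
  | limit B α hα h ih =>
    rcases hβ.lt_or_eq with hlt | rfl
    · exact h β hlt
    · exact .limit B _ hα h

theorem HasRank.unique {n : ℕ} {A B : Set (Meq L M)} {α β : Ordinal.{w}} (hα : HasRank n A B α)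
    (hβ : HasRank n A B β) : α = β := by
  rcases lt_trichotomy α β with h | h | h
  · exact absurd (hβ.1.of_le (Order.succ_le_of_lt h)) hα.2
  · exact h
  · exact absurd (hα.1.of_le (Order.succ_le_of_lt h)) hβ.2

theorem rank_eq_coe_iff {n : ℕ} {A B : Set (Meq L M)} {α : Ordinal.{w}} :
    rank n A B = (α : WithTop Ordinal.{w}) ↔ HasRank n A B α := by
  unfold rank
  split_ifs with h
  · rw [WithTop.coe_inj]
    exact ⟨fun e => e ▸ h.choose_spec, fun hα => h.choose_spec.unique hα⟩
  · simp only [WithTop.top_ne_coe, false_iff]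
    exact fun hα => h ⟨α, hα⟩

/-- `Indep n A B C` says that `A` is `n`-independent from `B` over `C`: for every finite `A' ⊆ A`,
`rk^n(A' / B ∪ C) = rk^n(A' / C)`. -/
def Indep (n : ℕ) (A B C : Set (Meq L M)) : Prop :=
  ∀ A' ⊆ A, A'.Finite → rank n A' (B ∪ C) = rank n A' C

end

/-! ### Saturation, the exchange property and independence relations -/

/-- `M` is `κ`-saturated: every set of formulas in one variable, with parameters from a set of fewer
than `κ` elements, that is finitely satisfiable in `M` is realized in `M`. -/
def IsSaturated (L : FirstOrder.Language.{u, v}) (M : Type w) [L.Structure M] (κ : Cardinal.{w}) : Prop :=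
  ∀ A : Set M, #A < κ → ∀ p : Set (L[[A]].Formula (Fin 1)),
    (∀ p₀ : Finset (L[[A]].Formula (Fin 1)), (p₀ : Set (L[[A]].Formula (Fin 1))) ⊆ p →
      ∃ x : Fin 1 → M, ∀ φ ∈ p₀, φ.Realize x) →
    ∃ x : Fin 1 → M, ∀ φ ∈ p, φ.Realize x

/-- The exchange property with respect to `n`, for parameter sets of fewer than `κ` elements. -/
def ExchangeProperty (L : FirstOrder.Language.{u, v}) (M : Type w) [L.Structure M] (κ : Cardinal.{w})
    (n : ℕ) : Prop :=
  ∀ C : Set (Meq L M), #C < κ → ∀ (k : ℕ) (a : ℕ → Meq L M), 2 ≤ k →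
    (∀ i ∈ Set.Icc 1 k, a i ∈ level L M n ∧ rank n {a i} C = ((1 : Ordinal.{w}) : WithTop Ordinal.{w})) →
    a k ∈ aclEq (a '' Set.Ico 1 k ∪ C) \ aclEq (a '' Set.Ico 2 k ∪ C) →
    a 1 ∈ aclEq (a '' Set.Icc 2 k ∪ C)

/-- `IsIndependenceRelationOn κ X Γ` says that `Γ`, where `Γ A B C` is read as "`A` is independent
from `B` over `C`" and is considered for finite `A` only, is an independence relation restricted to
`X ⊆ M^eq`, where all sets of parameters have fewer than `κ` elements. -/
structure IsIndependenceRelationOn {L : FirstOrder.Language.{u, v}} {M : Type w} [L.Structure M]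
    (κ : Cardinal.{w}) (X : Set (Meq L M))
    (Γ : Set (Meq L M) → Set (Meq L M) → Set (Meq L M) → Prop) : Prop where
  invariance : ∀ A B C : Set (Meq L M), A.Finite → #B < κ → #C < κ → A ⊆ X → B ⊆ X → C ⊆ X →
    ∀ (D : Set (Meq L M)) (σ : Meq L M → Meq L M), A ∪ B ∪ C ⊆ D → IsElementaryOn σ D →
      (Γ A B C ↔ Γ (σ '' A) (σ '' B) (σ '' C))
  local_character : ∀ A B : Set (Meq L M), A.Finite → #B < κ → A ⊆ X → B ⊆ X →
    ∃ C ⊆ B, C.Countable ∧ Γ A B C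
  finite_character : ∀ A B C : Set (Meq L M), A.Finite → #B < κ → #C < κ → A ⊆ X → B ⊆ X → C ⊆ X →
    (Γ A B C ↔ ∀ B' ⊆ B, B'.Finite → Γ A B' C)
  extension : ∀ (m : ℕ) (a : Fin m → Meq L M) (B C : Set (Meq L M)), #B < κ → (∀ i, a i ∈ X) →
    B ⊆ X → C ⊆ B →
    ∃ a' : Fin m → Meq L M, tp C a' = tp C a ∧ Γ (Set.range a') B C
  monotonicity : ∀ A B C D : Set (Meq L M), A.Finite → #D < κ → A ⊆ X → D ⊆ X → B ⊆ C → C ⊆ D →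
    Γ A D B → Γ A C B ∧ Γ A D C
  transitivity : ∀ A B C D : Set (Meq L M), A.Finite → #D < κ → A ⊆ X → D ⊆ X → B ⊆ C → C ⊆ D →
    Γ A C B → Γ A D C → Γ A D B
  symmetry : ∀ A B C : Set (Meq L M), A.Finite → B.Finite → #C < κ → A ⊆ X → B ⊆ X → C ⊆ X →
    (Γ A B C ↔ Γ B A C)

end NIndep

/-! Everything rests on one finiteness fact: if `F` is finite then `acl n F` is finite
(`finite_acl`). By Ryll-Nardzewski (`finitelyManyTypes`) there are finitely many types of
`k`-tuples, hence finitely many definable equivalence relations on each power of `M`. So `M_n` has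
finitely many sorts, and a finite set has finitely many algebraic elements in each. To compute with
types in `M^eq`, equality of types of finite tuples is replaced by `Conj`: both tuples arise by the
same recipe from real tuples of equal type. Conjugacy has back-and-forth, preserves formulas and has
definable classes.

For finite `A`, each step in the rank enlarges `acl n B` inside the finite set `acl n A`, so the
rank is a natural number `nrk`, and a finite part of the base already determines it
(`exists_finite_nrk_eq`). Local and finite character follow. Invariance follows from invariance of
`nrk` under equality of types. Monotonicity and transitivity only use that the rank decreases as the
base grows.

Exchange enters through maximal chains of elements of `acl n A`, each of rank one over its
predecessors. One such chain has length `nrk` (`exists_rankOneChain`), and exchange makes all of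
them equally long (`RankOneChain.length_unique`). Concatenating chains gives additivity (`nrk_add`),
so the rank of `A ∪ B` over `C` splits in two ways, which is symmetry. Additivity also reduces
independence of a finite `A` to one equation of ranks (`indep_iff_nrk_eq`).

For extension, the witnesses of the rank of `a` over `C` are copied one at a time by saturation,
each copy being kept nonalgebraic over `B`; a copy of `a` itself is added last
(`IsSaturated.exists_eqTp_rankGE`). -/

namespace NIndep

/-! ### Types of finite tuples and the Ryll-Nardzewski theorem -/

section Types

variable {L : FirstOrder.Language.{u, v}} {M : Type*} {N : Type*} {P : Type*}
  [L.Structure M] [L.Structure N] [L.Structure P] {α β γ : Type*}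

/-- Two tuples, possibly in different structures, satisfy the same formulas. -/
def SameType (L : FirstOrder.Language.{u, v}) {M N : Type*} [L.Structure M] [L.Structure N]
    (x : α → M) (y : α → N) : Prop :=
  ∀ φ : L.Formula α, φ.Realize x ↔ φ.Realize y

theorem SameType.refl (x : α → M) : SameType L x x := fun _ => Iff.rfl

theorem SameType.symm {x : α → M} {y : α → N} (h : SameType L x y) : SameType L y x :=
  fun φ => (h φ).symm

theorem SameType.trans {x : α → M} {y : α → N} {z : α → P} (h : SameType L x y)
    (h' : SameType L y z) : SameType L x z :=
  fun φ => (h φ).trans (h' φ)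

theorem SameType.comp {x : α → M} {y : α → N} (h : SameType L x y) (f : β → α) :
    SameType L (x ∘ f) (y ∘ f) := fun φ => by
  simpa [Language.Formula.realize_relabel] using h (φ.relabel f)

theorem SameType.mem_iff {x y : α → M} (h : SameType L x y) {D : Set (α → M)}
    (hD : (∅ : Set M).Definable L D) : x ∈ D ↔ y ∈ D := by
  obtain ⟨φ, rfl⟩ := Set.empty_definable_iff.1 hD
  exact h φ

theorem sameType_of_imp {x : α → M} {y : α → N}
    (h : ∀ φ : L.Formula α, φ.Realize x → φ.Realize y) : SameType L x y := fun φ =>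
  ⟨h φ, fun hy => by
    by_contra hx
    exact (Language.Formula.realize_not.1 (h φ.not (Language.Formula.realize_not.2 hx))) hy⟩

theorem exists_formula_of_not_sameType {x : α → M} {y : α → N} (h : ¬ SameType L x y) :
    ∃ φ : L.Formula α, φ.Realize x ∧ ¬ φ.Realize y := by
  by_contra hc
  push Not at hc
  exact h (sameType_of_imp hc)

/-- A formula satisfied by a tuple of the form `y ∘ f` with `y` satisfying `φ`. -/
theorem exists_image_formula [Finite α] [Finite β] (φ : L.Formula α) (f : β → α) :
    ∃ ψ : L.Formula β, ∀ x : β → M, ψ.Realize x ↔ ∃ y : α → M, φ.Realize y ∧ y ∘ f = x := by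
  have hD : (∅ : Set M).Definable L {y : α → M | φ.Realize y} :=
    Set.empty_definable_iff.2 ⟨φ, rfl⟩
  obtain ⟨ψ, hψ⟩ := Set.empty_definable_iff.1 (hD.image_comp f)
  refine ⟨ψ, fun x => ?_⟩
  exact (Set.ext_iff.1 hψ x).symm

/-- Having an extension that satisfies `φ` is itself expressed by a formula, namely the projection
of `φ`. -/
theorem SameType.exists_lift [Finite α] [Finite β] {y : α → M} {f : β → α} {x : β → M}
    (h : SameType L (y ∘ f) x) (φ : L.Formula α) (hφ : φ.Realize y) :
    ∃ z : α → M, φ.Realize z ∧ z ∘ f = x := by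
  obtain ⟨ψ, hψ⟩ := exists_image_formula (M := M) φ f
  exact (hψ x).1 ((h ψ).1 ((hψ _).2 ⟨y, hφ, rfl⟩))

/-- The type of the tuple `x` is isolated. -/
def Isolated (L : FirstOrder.Language.{u, v}) {M : Type*} [L.Structure M] (x : α → M) : Prop :=
  ∃ φ : L.Formula α, φ.Realize x ∧ ∀ y : α → M, φ.Realize y → SameType L x y

theorem Isolated.of_sameType {x y : α → M} (hx : Isolated L x) (h : SameType L x y) :
    Isolated L y := by
  obtain ⟨φ, hφ, hi⟩ := hx
  exact ⟨φ, (h φ).1 hφ, fun z hz => h.symm.trans (hi z hz)⟩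

theorem Isolated.comp [Finite α] [Finite β] {x : α → M} (hx : Isolated L x) (f : β → α) :
    Isolated L (x ∘ f) := by
  obtain ⟨φ, hφ, hi⟩ := hx
  obtain ⟨ψ, hψ⟩ := exists_image_formula (M := M) φ f
  refine ⟨ψ, (hψ _).2 ⟨x, hφ, rfl⟩, fun y hy => ?_⟩
  obtain ⟨z, hz, rfl⟩ := (hψ y).1 hy
  exact (hi z hz).comp f

/-- Every countable set of formulas in finitely many variables that is finitely satisfiable is
satisfied by some tuple. -/
def RealizesCountable (L : FirstOrder.Language.{u, v}) (N : Type*) [L.Structure N] : Prop :=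
  ∀ (k : ℕ) (D : ℕ → L.Formula (Fin k)),
    (∀ j, ∃ x : Fin k → N, ∀ i < j, (D i).Realize x) → ∃ x : Fin k → N, ∀ i, (D i).Realize x

/-- Diagonalization: if no tuple satisfying `φ` were isolated, `φ` could be shrunk repeatedly, each
time excluding the next tuple of an enumeration of all tuples; the resulting countable set of
formulas would be finitely satisfiable but not satisfied. -/
theorem exists_isolated_fin [Countable N] (hN : RealizesCountable L N) {k : ℕ}
    (φ : L.Formula (Fin k)) {x : Fin k → N} (hx : φ.Realize x) :
    ∃ y : Fin k → N, φ.Realize y ∧ Isolated L y := by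
  by_contra! hc
  have step : ∀ (ψ : L.Formula (Fin k)) (b : Fin k → N), (∃ y : Fin k → N, ψ.Realize y) →
      (∀ y : Fin k → N, ψ.Realize y → φ.Realize y) →
      ∃ ψ' : L.Formula (Fin k), (∃ y : Fin k → N, ψ'.Realize y) ∧
        (∀ y : Fin k → N, ψ'.Realize y → ψ.Realize y) ∧ ¬ ψ'.Realize b := by
    rintro ψ b ⟨y, hy⟩ hψ
    have hni := hc y (hψ y hy)
    obtain ⟨z, hz, hyz⟩ : ∃ z, ψ.Realize z ∧ ¬ SameType L y z := by
      by_contra! h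
      exact hni ⟨ψ, hy, h⟩
    obtain ⟨θ, hθy, hθz⟩ := exists_formula_of_not_sameType hyz
    by_cases hb : θ.Realize b
    · exact ⟨ψ ⊓ θ.not, ⟨z, by simp [hz, hθz]⟩, fun y h => by simp at h; exact h.1, by simp [hb]⟩
    · exact ⟨ψ ⊓ θ, ⟨y, by simp [hy, hθy]⟩, fun y h => by simp at h; exact h.1, by simp [hb]⟩
  choose! s hs using step
  have : Nonempty (Fin k → N) := ⟨x⟩
  obtain ⟨b, hb⟩ := exists_surjective_nat (Fin k → N)
  let D : ℕ → L.Formula (Fin k) := fun i => Nat.rec φ (fun i ψ => s ψ (b i)) i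
  have hD : ∀ i, (∃ y : Fin k → N, (D i).Realize y) ∧
      (∀ y : Fin k → N, (D i).Realize y → φ.Realize y) := by
    intro i
    induction i with
    | zero => exact ⟨⟨x, hx⟩, fun _ h => h⟩
    | succ i ih =>
      have := hs (D i) (b i) ih.1 ih.2
      exact ⟨this.1, fun y hy => ih.2 y (this.2.1 y hy)⟩
  have hanti : ∀ i j, i ≤ j → ∀ y : Fin k → N, (D j).Realize y → (D i).Realize y := by
    intro i j hij
    induction hij with
    | refl => exact fun _ h => h
    | step _ ih => exact fun y hy => ih y ((hs _ _ (hD _).1 (hD _).2).2.1 y hy)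
  obtain ⟨y, hy⟩ := hN k D fun j => by
    obtain ⟨y, hy⟩ := (hD j).1
    exact ⟨y, fun i hi => hanti i j hi.le y hy⟩
  obtain ⟨i, rfl⟩ := hb y
  exact (hs _ _ (hD i).1 (hD i).2).2.2 (hy (i + 1))

theorem exists_isolated [Countable N] [Finite α] (hN : RealizesCountable L N)
    (φ : L.Formula α) {x : α → N} (hx : φ.Realize x) :
    ∃ y : α → N, φ.Realize y ∧ Isolated L y := by
  obtain ⟨k, ⟨e⟩⟩ := Finite.exists_equiv_fin α
  obtain ⟨y, hy, hi⟩ := exists_isolated_fin hN (φ.relabel e) (x := x ∘ e.symm)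
    (by simpa [Language.Formula.realize_relabel, Function.comp_assoc] using hx)
  exact ⟨y ∘ e, by simpa [Language.Formula.realize_relabel] using hy, hi.comp e⟩

/-- Isolated types are dense, so some tuple satisfying `φ` is isolated and has a first part of the
type of `x`; its isolating formula is then lifted back to `x`. -/
theorem Isolated.exists_extension [Countable N] [Finite α] [Finite β] (hN : RealizesCountable L N)
    {x : α → N} (hx : Isolated L x) (φ : L.Formula (α ⊕ β)) {a : β → N}
    (ha : φ.Realize (Sum.elim x a)) :
    ∃ b : β → N, φ.Realize (Sum.elim x b) ∧ Isolated L (Sum.elim x b) := by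
  obtain ⟨ψ, hψ, hi⟩ := hx
  obtain ⟨y, hy, χ, hχ, hχi⟩ := exists_isolated hN (φ ⊓ ψ.relabel Sum.inl) (x := Sum.elim x a)
    (by simp [Language.Formula.realize_relabel, ha, hψ])
  simp only [Language.Formula.realize_inf, Language.Formula.realize_relabel] at hy
  obtain ⟨z, hz, hzx⟩ := (hi _ hy.2).symm.exists_lift (f := Sum.inl) (φ ⊓ χ) (by simp [hy.1, hχ])
  obtain ⟨b, rfl⟩ : ∃ b, z = Sum.elim x b := ⟨z ∘ Sum.inr, by rw [← hzx, Sum.elim_comp_inl_inr]⟩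
  simp only [Language.Formula.realize_inf] at hz
  exact ⟨b, hz.1, χ, hz.2, fun w hw => (hχi _ hz.2).symm.trans (hχi _ hw)⟩

/-- The finite subsets of `N` that are enumerated by a tuple with isolated type. -/
abbrev IsolatedFinset (L : FirstOrder.Language.{u, v}) (N : Type*) [L.Structure N] :=
  {A : Finset N // Isolated L (Subtype.val : A → N)}

/-- This is the Tarski-Vaught requirement for `φ` with parameters `F`. The first alternative, that
`F` is never reached above `A`, makes the set cofinal without assuming `F` contained in `A`. -/
theorem isCofinal_isolatedFinset [Countable N] (hN : RealizesCountable L N) (F : Finset N)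
    (φ : L.Formula (F ⊕ Fin 1)) :
    IsCofinal {A : IsolatedFinset L N | (∀ A' ≥ A, ¬ F ⊆ A'.1) ∨
      ((∃ a : Fin 1 → N, φ.Realize (Sum.elim Subtype.val a)) →
        ∃ a : Fin 1 → N, φ.Realize (Sum.elim Subtype.val a) ∧ a 0 ∈ A.1)} := by
  classical
  intro A
  by_cases h : ∀ A' ≥ A, ¬ F ⊆ A'.1
  · exact ⟨A, Or.inl h, le_rfl⟩
  push Not at h
  obtain ⟨A', hA', hF⟩ := h
  by_cases ha : ∃ a : Fin 1 → N, φ.Realize (Sum.elim Subtype.val a)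
  · obtain ⟨a, ha⟩ := ha
    let ι : F → A'.1 := fun x => ⟨x.1, hF x.2⟩
    obtain ⟨b, hb, hi⟩ := A'.2.exists_extension hN (φ.relabel (Sum.map ι id)) (a := a) (by
      rw [Language.Formula.realize_relabel, Sum.elim_comp_map]; exact ha)
    rw [Language.Formula.realize_relabel, Sum.elim_comp_map] at hb
    let f : (insert (b 0) A'.1 : Finset N) → A'.1 ⊕ Fin 1 := fun x =>
      if hx : x.1 ∈ A'.1 then Sum.inl ⟨x.1, hx⟩ else Sum.inr 0
    have hf : Sum.elim Subtype.val b ∘ f = Subtype.val := by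
      funext x
      by_cases hx : x.1 ∈ A'.1
      · simp [f, hx]
      · have := x.2
        rw [Finset.mem_insert] at this
        simp only [Function.comp_apply, f, dif_neg hx, Sum.elim_inr]
        exact (this.resolve_right hx).symm
    refine ⟨⟨insert (b 0) A'.1, hf ▸ hi.comp f⟩, Or.inr fun _ => ⟨b, hb, by simp⟩, ?_⟩
    exact hA'.trans (Finset.subset_insert _ _)
  · exact ⟨A, Or.inr fun h => absurd h ha, le_rfl⟩

/-- An elementary substructure all of whose finite tuples have isolated types. -/
theorem exists_atomic_elementarySubstructure [Countable N] (hL : Countable L.Symbols)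
    (hN : RealizesCountable L N) :
    ∃ S : L.ElementarySubstructure N, ∀ (k : ℕ) (x : Fin k → S),
      Isolated L (fun i => (x i : N)) := by
  classical
  let ι := Σ F : Finset N, L.Formula (F ⊕ Fin 1)
  have : Encodable ι := Encodable.ofCountable ι
  let D : ι → Order.Cofinal (IsolatedFinset L N) := fun i => ⟨_, isCofinal_isolatedFinset hN i.1 i.2⟩
  have h0 : Isolated L (Subtype.val : (∅ : Finset N) → N) := by
    obtain ⟨y, -, hy⟩ := exists_isolated hN (⊤ : L.Formula (∅ : Finset N)) (x := Subtype.val)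
      (by simp)
    rwa [Subsingleton.elim y Subtype.val] at hy
  -- A generic ideal in the sense of Rasiowa-Sikorski: it meets each of the countably many
  -- Tarski-Vaught requirements.
  let I := Order.idealOfCofinals (⟨∅, h0⟩ : IsolatedFinset L N) D
  let A : Set N := {a | ∃ s ∈ I, a ∈ s.1}
  have hfin : ∀ F : Finset N, (F : Set N) ⊆ A → ∃ s ∈ I, F ⊆ s.1 := by
    intro F
    induction F using Finset.induction with
    | empty => exact fun _ => ⟨⟨∅, h0⟩, Order.mem_idealOfCofinals _ _, by simp⟩
    | insert a F _ ih =>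
      intro hF
      rw [Finset.coe_insert, Set.insert_subset_iff] at hF
      obtain ⟨s, hs, hFs⟩ := ih hF.2
      obtain ⟨t, ht, hat⟩ := hF.1
      obtain ⟨r, hr, hsr, htr⟩ := I.directed s hs t ht
      exact ⟨r, hr, Finset.insert_subset (htr hat) (hFs.trans hsr)⟩
  have hA : L.MeetsDefinable A := by
    intro X hX hXA
    obtain ⟨F, hFA, hF⟩ := Set.definable_iff_finitely_definable.1 hXA
    obtain ⟨φ, hφ⟩ := Set.definable_iff_exists_formula_sum.1 hF
    have hφ' : ∀ a : Fin 1 → N, a 0 ∈ X ↔ φ.Realize (Sum.elim Subtype.val a) :=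
      fun a => Set.ext_iff.1 hφ a
    obtain ⟨s, hsD, hsI⟩ := Order.cofinal_meets_idealOfCofinals
      (⟨∅, h0⟩ : IsolatedFinset L N) D ⟨F, φ⟩
    obtain ⟨t, ht, hFt⟩ := hfin F hFA
    obtain ⟨r, hr, hsr, htr⟩ := I.directed s hsI t ht
    rcases hsD with h | h
    · exact absurd (hFt.trans htr) (h r hsr)
    · obtain ⟨x, hx⟩ := hX
      obtain ⟨a, ha, has⟩ := h ⟨fun _ => x, (hφ' _).1 hx⟩
      exact ⟨a 0, (hφ' a).2 ha, s, hsI, has⟩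
  refine ⟨hA.toElementarySubstructure, fun k x => ?_⟩
  have hx : ∀ i, (x i : N) ∈ A := fun i => by
    have := (x i).2
    change (x i : N) ∈ (Language.Substructure.closure L A : Set N) at this
    rwa [hA.closure_eq_self] at this
  obtain ⟨s, -, hs⟩ := hfin (Finset.univ.image fun i => (x i : N)) (by
    intro a ha
    simp only [Finset.coe_image, Finset.coe_univ, Set.image_univ, Set.mem_range] at ha
    obtain ⟨i, rfl⟩ := ha
    exact hx i)
  exact s.2.comp (fun i : Fin k => (⟨(x i : N), hs (by simp)⟩ : s.1))

theorem SameType.of_elementaryEmbedding (f : M ↪ₑ[L] N) (x : α → M) : SameType L x (f ∘ x) :=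
  fun φ => (f.map_formula φ x).symm

/-- In a countable structure that is isomorphic to all its elementary substructures and realizes
its finitely satisfiable sets of formulas, there are only finitely many types of `k`-tuples. -/
theorem exists_isolating_finset [Countable N] (hL : Countable L.Symbols)
    (hN : RealizesCountable L N)
    (hiso : ∀ S : L.ElementarySubstructure N, Nonempty (N ≃[L] S)) (k : ℕ) :
    ∃ F : Finset (L.Formula (Fin k)), (∀ y : Fin k → N, ∃ ψ ∈ F, ψ.Realize y) ∧
      ∀ ψ ∈ F, ∀ y z : Fin k → N, ψ.Realize y → ψ.Realize z → SameType L y z := by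
  classical
  obtain ⟨S, hS⟩ := exists_atomic_elementarySubstructure hL hN
  obtain ⟨e⟩ := hiso S
  -- An isomorphism with an atomic elementary substructure makes `N` itself atomic.
  have hatom : ∀ x : Fin k → N, Isolated L x := fun x =>
    (hS k (e ∘ x)).of_sameType
      (SameType.of_elementaryEmbedding (S.subtype.comp e.toElementaryEmbedding) x).symm
  choose ψ hψ hi using hatom
  by_cases hne : Nonempty (Fin k → N)
  swap
  · exact ⟨∅, fun y => absurd ⟨y⟩ hne, by simp⟩
  obtain ⟨b, hb⟩ := exists_surjective_nat (Fin k → N)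
  -- Compactness: otherwise the negations of all isolating formulas would be satisfied by one tuple,
  -- contradicting its own isolating formula.
  obtain ⟨j, hj⟩ : ∃ j, ∀ x : Fin k → N, ∃ i < j, (ψ (b i)).Realize x := by
    by_contra! hc
    obtain ⟨x, hx⟩ := hN k (fun i => (ψ (b i)).not) fun j => by
      obtain ⟨x, hx⟩ := hc j
      exact ⟨x, fun i hi => Language.Formula.realize_not.2 (hx i hi)⟩
    obtain ⟨i, rfl⟩ := hb x
    exact Language.Formula.realize_not.1 (hx i) (hψ _)
  refine ⟨(Finset.range j).image fun i => ψ (b i), fun y => ?_, fun χ hχ y z hy hz => ?_⟩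
  · obtain ⟨i, hij, h⟩ := hj y
    exact ⟨_, Finset.mem_image.2 ⟨i, Finset.mem_range.2 hij, rfl⟩, h⟩
  · obtain ⟨i, -, rfl⟩ := Finset.mem_image.1 hχ
    exact (hi _ _ hy).symm.trans (hi _ _ hz)

end Types

/-! ### Saturation for finite tuples of variables -/

section Saturation

variable {L : FirstOrder.Language.{u, v}} {M : Type w} [L.Structure M]

theorem definable_coord_eq {α : Type*} {A : Set M} {a : M} (ha : a ∈ A) (i : α) :
    A.Definable L {x : α → M | x i = a} :=
  Set.DefinableFun.ofPred_eq_const (.proj L) ha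

theorem mk_insert_lt {κ : Cardinal.{w}} (hκ : ℵ₀ ≤ κ) {A : Set M} (hA : #A < κ) (a : M) :
    #(insert a A : Set M) < κ :=
  mk_insert_le.trans_lt (add_lt_of_lt hκ hA (one_lt_aleph0.trans_le hκ))

theorem IsSaturated.exists_mem_one {κ : Cardinal.{w}} (hsat : IsSaturated L M κ) {A : Set M}
    (hA : #A < κ) {ι : Type*} (X : ι → Set (Fin 1 → M)) (hX : ∀ i, A.Definable L (X i))
    (hfip : ∀ s : Finset ι, ∃ x, ∀ i ∈ s, x ∈ X i) : ∃ x, ∀ i, x ∈ X i := by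
  classical
  choose φ hφ using hX
  obtain ⟨x, hx⟩ := hsat A hA (Set.range φ) fun p₀ hp₀ => by
    obtain ⟨s, -, rfl⟩ := Finset.subset_set_image_iff.1 (Set.image_univ.symm ▸ hp₀ :
      (p₀ : Set _) ⊆ φ '' Set.univ)
    obtain ⟨x, hx⟩ := hfip s
    refine ⟨x, fun ψ hψ => ?_⟩
    obtain ⟨i, hi, rfl⟩ := Finset.mem_image.1 hψ
    have := hx i hi
    rw [hφ i] at this
    exact this
  refine ⟨x, fun i => ?_⟩
  rw [hφ i]
  exact hx _ ⟨i, rfl⟩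

theorem IsSaturated.exists_mem_fin {κ : Cardinal.{w}} (hκ : ℵ₀ ≤ κ) (hsat : IsSaturated L M κ)
    (k : ℕ) : ∀ {A : Set M}, #A < κ → ∀ {ι : Type*} (X : ι → Set (Fin k → M)),
    (∀ i, A.Definable L (X i)) → (∀ s : Finset ι, ∃ x, ∀ i ∈ s, x ∈ X i) → ∃ x, ∀ i, x ∈ X i := by
  classical
  induction k with
  | zero =>
    intro A hA ι X hX hfip
    refine ⟨Fin.elim0, fun i => ?_⟩
    obtain ⟨x, hx⟩ := hfip {i}
    rw [Subsingleton.elim Fin.elim0 x]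
    exact hx i (by simp)
  | succ k ih =>
    intro A hA ι X hX hfip
    -- The first coordinate is found by projecting all finite intersections; it then becomes a
    -- parameter for the remaining `k` coordinates.
    let f : Fin 1 → Fin (k + 1) := fun _ => 0
    obtain ⟨a, ha⟩ := hsat.exists_mem_one hA
      (fun s : Finset ι => (fun x : Fin (k + 1) → M => x ∘ f) '' ⋂ i ∈ s, X i)
      (fun s => (Set.definable_biInter_finset hX s).image_comp f) (fun T => by
        obtain ⟨x, hx⟩ := hfip (T.biUnion id)
        refine ⟨x ∘ f, fun s hs => ⟨x, ?_, rfl⟩⟩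
        simp only [Set.mem_iInter]
        exact fun i hi => hx i (Finset.mem_biUnion.2 ⟨s, hs, hi⟩))
    obtain ⟨y, hy⟩ := ih (mk_insert_lt hκ hA (a 0))
      (fun i => (fun x : Fin (k + 1) → M => x ∘ Fin.succ) '' (X i ∩ {x | x 0 = a 0}))
      (fun i => (((hX i).mono (Set.subset_insert _ _)).inter
        (definable_coord_eq (Set.mem_insert _ _) 0)).image_comp Fin.succ) (fun s => by
        obtain ⟨x, hx, hxa⟩ := ha s
        simp only [Set.mem_iInter] at hx
        exact ⟨x ∘ Fin.succ, fun i hi => ⟨x, ⟨hx i hi, congrFun hxa 0⟩, rfl⟩⟩)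
    refine ⟨Fin.cons (a 0) y, fun i => ?_⟩
    obtain ⟨x, ⟨hx, hx0⟩, hxy⟩ := hy i
    convert hx
    funext j
    refine Fin.cases hx0.symm (fun j => ?_) j
    rw [← hxy]
    rfl

theorem IsSaturated.exists_mem {κ : Cardinal.{w}} (hκ : ℵ₀ ≤ κ) (hsat : IsSaturated L M κ)
    {α : Type*} [Finite α] {A : Set M} (hA : #A < κ) {ι : Type*} (X : ι → Set (α → M))
    (hX : ∀ i, A.Definable L (X i)) (hfip : ∀ s : Finset ι, ∃ x, ∀ i ∈ s, x ∈ X i) :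
    ∃ x, ∀ i, x ∈ X i := by
  obtain ⟨k, ⟨e⟩⟩ := Finite.exists_equiv_fin α
  obtain ⟨x, hx⟩ := hsat.exists_mem_fin hκ k hA
    (fun i => (fun x : Fin k → M => x ∘ e) ⁻¹' X i)
    (fun i => by
      have := (hX i).image_comp e.symm
      convert! this using 1
      ext x
      refine ⟨fun h => ⟨_, h, by simp [Function.comp_assoc]⟩, ?_⟩
      rintro ⟨y, hy, rfl⟩
      simpa [Function.comp_assoc] using hy) (fun s => by
      obtain ⟨x, hx⟩ := hfip s
      exact ⟨x ∘ e.symm, fun i hi => by simpa [Function.comp_assoc] using hx i hi⟩)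
  exact ⟨_, hx⟩

end Saturation

/-! ### The Ryll-Nardzewski theorem and its consequences -/

section RyllNardzewski

variable {L : FirstOrder.Language.{u, v}} {M : Type w} [L.Structure M]

/-- For every `k` there are only finitely many types of `k`-tuples, all of them isolated. -/
def FinitelyManyTypes (L : FirstOrder.Language.{u, v}) (M : Type w) [L.Structure M] : Prop :=
  ∀ k, ∃ F : Finset (L.Formula (Fin k)), (∀ y : Fin k → M, ∃ ψ ∈ F, ψ.Realize y) ∧
    ∀ ψ ∈ F, ∀ y z : Fin k → M, ψ.Realize y → ψ.Realize z → SameType L y z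

theorem exists_realize_of_elementarySubstructure {α : Type*} [Finite α]
    (S : L.ElementarySubstructure M) (φ : L.Formula α) {x : α → M} (hx : φ.Realize x) :
    ∃ y : α → S, φ.Realize y := by
  let ψ : L.Sentence := (φ.relabel (Sum.inr : α → Empty ⊕ α)).iExs α
  have h : M ⊨ ψ := by
    simp only [Language.Sentence.Realize, ψ, Language.Formula.realize_iExs,
      Language.Formula.realize_relabel]
    exact ⟨x, hx⟩
  have h' := (S.realize_sentence ψ).2 h
  simp only [Language.Sentence.Realize, ψ, Language.Formula.realize_iExs,
    Language.Formula.realize_relabel] at h'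
  obtain ⟨y, hy⟩ := h'
  exact ⟨y, hy⟩

/-- A tuple missed by `F`, or two tuples of different types sharing a formula of `F`, would satisfy
a formula in `M`, and that formula would then be satisfied in `S` as well. -/
theorem FinitelyManyTypes.of_elementarySubstructure (S : L.ElementarySubstructure M)
    (hS : FinitelyManyTypes L S) : FinitelyManyTypes L M := by
  intro k
  obtain ⟨F, hF, hF'⟩ := hS k
  refine ⟨F, fun y => ?_, fun ψ hψ y z hy hz => ?_⟩
  · by_contra! hc
    obtain ⟨x, hx⟩ := exists_realize_of_elementarySubstructure S
      (Language.Formula.iInf fun ψ : F => ψ.1.not) (x := y)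
      (by
        rw [Language.Formula.realize_iInf]
        exact fun ψ => Language.Formula.realize_not.2 (hc ψ.1 ψ.2))
    rw [Language.Formula.realize_iInf] at hx
    obtain ⟨ψ, hψ, h⟩ := hF x
    exact Language.Formula.realize_not.1 (hx ⟨ψ, hψ⟩) h
  · by_contra hc
    obtain ⟨θ, hy', hz'⟩ := exists_formula_of_not_sameType hc
    obtain ⟨x, hx⟩ := exists_realize_of_elementarySubstructure S
      (((ψ ⊓ θ).relabel (Sum.inl : Fin k → Fin k ⊕ Fin k)) ⊓
        ((ψ ⊓ θ.not).relabel (Sum.inr : Fin k → Fin k ⊕ Fin k))) (x := Sum.elim y z)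
      (by simp [Language.Formula.realize_relabel, hy, hz, hy', hz'])
    simp only [Language.Formula.realize_inf, Language.Formula.realize_relabel,
      Language.Formula.realize_not] at hx
    exact hx.2.2 ((hF' ψ hψ _ _ hx.1.1 hx.2.1 θ).1 hx.1.2)

theorem FinitelyManyTypes.of_finite [Finite M] : FinitelyManyTypes L M := by
  classical
  intro k
  cases nonempty_fintype (Fin k → M)
  have : ∀ x : Fin k → M, ∃ φ : L.Formula (Fin k), φ.Realize x ∧
      ∀ y : Fin k → M, φ.Realize y → SameType L x y := by
    intro x
    choose θ hθ using fun y : {y : Fin k → M // ¬ SameType L x y} =>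
      exists_formula_of_not_sameType y.2
    refine ⟨Language.Formula.iInf θ, ?_, fun y hy => ?_⟩
    · rw [Language.Formula.realize_iInf]
      exact fun y => (hθ y).1
    · rw [Language.Formula.realize_iInf] at hy
      by_contra hc
      exact (hθ ⟨y, hc⟩).2 (hy _)
  choose φ hφ hφ' using this
  refine ⟨Finset.univ.image φ, fun y => ⟨φ y, by simp, hφ y⟩, fun ψ hψ y z hy hz => ?_⟩
  obtain ⟨x, -, rfl⟩ := Finset.mem_image.1 hψ
  exact (hφ' x y hy).symm.trans (hφ' x z hz)

/-- A part of the Ryll-Nardzewski theorem, for models of an `ℵ₀`-categorical theory that are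
saturated. -/
theorem finitelyManyTypes (hL : L.card ≤ ℵ₀) (T : L.Theory)
    (hcat : Cardinal.Categorical (ℵ₀ : Cardinal.{w}) T) [Nonempty M] [T.Model M]
    {κ : Cardinal.{w}} (hκ : ℵ₀ ≤ κ) (hsat : IsSaturated L M κ) : FinitelyManyTypes L M := by
  -- Categoricity in `ℵ₀` says nothing about a finite model, which is treated directly.
  rcases finite_or_infinite M with hM | hM
  · exact .of_finite
  have hLS : ∀ s : Set M, s.Countable → ∃ S : L.ElementarySubstructure M, s ⊆ S ∧ #S = ℵ₀ := by
    intro s hs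
    obtain ⟨S, hS, hc⟩ := Language.exists_elementarySubstructure_card_eq L s (ℵ₀ : Cardinal.{w})
      le_rfl (by simpa using hs) (by simpa using hL) (by simp)
    exact ⟨S, hS, by simpa using hc⟩
  have hiso : ∀ (N N' : Type w) [L.Structure N] [L.Structure N'] [Nonempty N] [Nonempty N']
      [T.Model N] [T.Model N'], #N = ℵ₀ → #N' = ℵ₀ → Nonempty (N ≃[L] N') := by
    intro N N' _ _ _ _ _ _ h h'
    exact hcat (.of T N) (.of T N') h h'
  obtain ⟨S, -, hS⟩ := hLS ∅ Set.countable_empty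
  have hSc : Countable S := mk_le_aleph0_iff.1 hS.le
  have hLc : Countable L.Symbols := mk_le_aleph0_iff.1 hL
  refine .of_elementarySubstructure S fun k => ?_
  refine exists_isolating_finset hLc ?_ ?_ k
  -- A realization exists in `M` by saturation; a countable elementary substructure containing it is
  -- isomorphic to `S` by categoricity.
  · intro k D hD
    obtain ⟨x, hx⟩ := hsat.exists_mem hκ (A := ∅) (by simpa using aleph0_pos.trans_le hκ)
      (fun i => {x : Fin k → M | (D i).Realize x})
      (fun i => Set.empty_definable_iff.2 ⟨_, rfl⟩) (fun s => by
        obtain ⟨x, hx⟩ := hD (s.sup id + 1)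
        refine ⟨S.subtype ∘ x, fun i hi => ?_⟩
        have := hx i (Nat.lt_succ_of_le (Finset.le_sup (f := id) hi))
        exact (S.subtype.map_formula _ _).2 this)
    obtain ⟨S', hxS, hS'⟩ := hLS (Set.range x) (Set.countable_range x)
    obtain ⟨e⟩ := hiso S' S hS' hS
    refine ⟨fun i => e ⟨x i, hxS ⟨i, rfl⟩⟩, fun i => ?_⟩
    have h1 : (D i).Realize (S'.subtype ∘ fun i => (⟨x i, hxS ⟨i, rfl⟩⟩ : S')) := hx i
    rw [S'.subtype.map_formula] at h1
    exact (e.toElementaryEmbedding.map_formula (D i) _).2 h1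
  · intro S'
    have hinf : Infinite S := infinite_iff.2 hS.ge
    have hinf' : Infinite S' := S'.elementarilyEquivalent.symm.infinite
    refine hiso S S' hS (le_antisymm (mk_le_aleph0_iff.2 inferInstance) (infinite_iff.1 hinf'))

namespace FinitelyManyTypes

variable {α β : Type*} [Finite α] [Finite β]

theorem exists_formula (h : FinitelyManyTypes L M) (x : α → M) :
    ∃ φ : L.Formula α, ∀ y : α → M, φ.Realize y ↔ SameType L x y := by
  obtain ⟨k, ⟨e⟩⟩ := Finite.exists_equiv_fin α
  obtain ⟨F, hF, hF'⟩ := h k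
  obtain ⟨ψ, hψ, hx⟩ := hF (x ∘ e.symm)
  have key : ∀ y : α → M, (ψ.relabel e.symm).Realize y ↔ ψ.Realize (y ∘ e.symm) := fun y => by
    rw [Language.Formula.realize_relabel]
  refine ⟨ψ.relabel e.symm, fun y => (key y).trans ⟨fun hy => ?_, fun hy => ?_⟩⟩
  · have := (hF' ψ hψ _ _ hx hy).comp e
    simpa [Function.comp_assoc] using this
  · exact (hy.comp e.symm ψ).1 hx

theorem definable_sameType (h : FinitelyManyTypes L M) (x : α → M) :
    (∅ : Set M).Definable L {y | SameType L x y} := by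
  obtain ⟨φ, hφ⟩ := h.exists_formula x
  exact Set.empty_definable_iff.2 ⟨φ, Set.ext fun y => (hφ y).symm⟩

theorem exists_finite_representatives (h : FinitelyManyTypes L M) (α : Type*) [Finite α] :
    ∃ S : Set (α → M), S.Finite ∧ ∀ y : α → M, ∃ x ∈ S, SameType L x y := by
  classical
  obtain ⟨k, ⟨e⟩⟩ := Finite.exists_equiv_fin α
  obtain ⟨F, hF, hF'⟩ := h k
  choose ψ hψ hy using hF
  refine ⟨Set.range fun χ : {χ : F // ∃ y, χ.1.Realize y} => (χ.2.choose : Fin k → M) ∘ e,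
    Set.finite_range _, fun y => ?_⟩
  let χ : {χ : F // ∃ y : Fin k → M, χ.1.Realize y} :=
    ⟨⟨ψ (y ∘ e.symm), hψ _⟩, _, hy _⟩
  refine ⟨_, ⟨χ, rfl⟩, ?_⟩
  have := (hF' _ (hψ (y ∘ e.symm)) _ _ χ.2.choose_spec (hy _)).comp e
  simpa [Function.comp_assoc] using this

/-- A set that is invariant under equality of types is definable. -/
theorem definable_of_invariant (h : FinitelyManyTypes L M) {D : Set (α → M)}
    (hD : ∀ x y, SameType L x y → x ∈ D → y ∈ D) : (∅ : Set M).Definable L D := by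
  obtain ⟨S, hS, hS'⟩ := h.exists_finite_representatives α
  have := hS.to_subtype
  have key := Set.definable_iUnion_of_finite
    (fun x : {x : S // x.1 ∈ D} => h.definable_sameType x.1.1)
  convert! key using 1
  ext y
  simp only [Set.mem_iUnion]
  constructor
  · intro hy
    obtain ⟨x, hx, hxy⟩ := hS' y
    exact ⟨⟨⟨x, hx⟩, hD _ _ hxy.symm hy⟩, hxy⟩
  · rintro ⟨x, hx⟩
    exact hD _ _ hx x.2

/-- A definable set is a union of types, so it is determined by its trace on a finite set of
representatives. -/
theorem finite_definable (h : FinitelyManyTypes L M) (α : Type*) [Finite α] :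
    {D : Set (α → M) | (∅ : Set M).Definable L D}.Finite := by
  obtain ⟨S, hS, hS'⟩ := h.exists_finite_representatives α
  refine Set.Finite.of_finite_image (f := fun D => D ∩ S) (hS.finite_subsets.subset ?_) ?_
  · rintro _ ⟨D, -, rfl⟩
    exact Set.inter_subset_right
  · intro D hD D' hD' hDD
    ext y
    obtain ⟨x, hx, hxy⟩ := hS' y
    rw [← hxy.mem_iff hD, ← hxy.mem_iff hD']
    have := Set.ext_iff.1 hDD x
    simpa [hx] using this

/-- The back-and-forth property. -/
theorem exists_extend (h : FinitelyManyTypes L M) {x y : α → M} (hxy : SameType L x y)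
    (a : β → M) : ∃ b : β → M, SameType L (Sum.elim x a) (Sum.elim y b) := by
  obtain ⟨φ, hφ⟩ := h.exists_formula (Sum.elim x a)
  obtain ⟨z, hz, rfl⟩ := SameType.exists_lift (y := Sum.elim x a) (f := Sum.inl) (x := y)
    (by simpa using hxy) φ ((hφ _).2 (.refl _))
  refine ⟨z ∘ Sum.inr, ?_⟩
  rw [Sum.elim_comp_inl_inr]
  exact (hφ z).1 hz

end FinitelyManyTypes

end RyllNardzewski

/-! ### Types of tuples of imaginary elements -/

section Conjugate

variable {L : FirstOrder.Language.{u, v}} {M : Type w} [L.Structure M]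

/-- A recipe for obtaining an element of `M^eq` from a tuple indexed by `β` of elements of `M`. -/
inductive Code (L : FirstOrder.Language.{u, v}) (M : Type w) [L.Structure M] (β : Type*)
  | real (j : β) : Code L M β
  | imag (k : ℕ) (E : DefEquiv L M (k + 1)) (f : Fin (k + 1) → β) : Code L M β

/-- The element of `M^eq` obtained from the tuple `r`. -/
def Code.eval {β : Type*} (r : β → M) : Code L M β → Meq L M
  | .real j => .real (r j)
  | .imag k E f => .imag k E (Quotient.mk E.rel (r ∘ f))

/-- Reindexing of codes. -/
def Code.map {β γ : Type*} (g : β → γ) : Code L M β → Code L M γ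
  | .real j => .real (g j)
  | .imag k E f => .imag k E (g ∘ f)

@[simp]
theorem Code.eval_map {β γ : Type*} (g : β → γ) (r : γ → M) (c : Code L M β) :
    (c.map g).eval r = c.eval (r ∘ g) := by
  cases c <;> rfl

/-- Two classes of the same sort coincide when their representatives are equivalent, a `∅`-definable
condition on `r`. -/
theorem Code.eval_eq_of_sameType {β : Type*} {r r' : β → M} (h : SameType L r r')
    {c d : Code L M β} (hcd : c.eval r = d.eval r) : c.eval r' = d.eval r' := by
  cases c with
  | real i =>
    cases d with
    | real j =>
      have hij : r i = r j := Meq.real.inj hcd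
      have := h ((Language.Term.var i).equal (Language.Term.var j))
      simp only [Language.Formula.realize_equal, Language.Term.realize_var] at this
      exact congrArg Meq.real (this.1 hij)
    | imag => exact absurd hcd (by simp [Code.eval])
  | imag k E f =>
    cases d with
    | real j => exact absurd hcd (by simp [Code.eval])
    | imag k' E' g =>
      obtain ⟨rfl, hE, hq⟩ := Meq.imag.inj hcd
      obtain rfl := eq_of_heq hE
      have hfg := Quotient.exact (eq_of_heq hq)
      have hD := (E.definable.preimage_comp (Sum.elim f g))
      have : r' ∈ _ := (h.mem_iff hD).1 hfg
      exact congrArg (Meq.imag k E) (Quotient.sound this)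

theorem Code.eval_eq_iff {β : Type*} {r r' : β → M} (h : SameType L r r')
    {c d : Code L M β} : c.eval r = d.eval r ↔ c.eval r' = d.eval r' :=
  ⟨eval_eq_of_sameType h, eval_eq_of_sameType h.symm⟩

theorem exists_code (x : Meq L M) : ∃ (m : ℕ) (r : Fin m → M) (c : Code L M (Fin m)),
    x = c.eval r := by
  cases x with
  | real y => exact ⟨1, fun _ => y, .real 0, rfl⟩
  | imag k E q =>
    obtain ⟨y, rfl⟩ := Quotient.exists_rep q
    exact ⟨k + 1, y, .imag k E id, rfl⟩

theorem exists_codes {α : Type*} [Finite α] (a : α → Meq L M) :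
    ∃ (m : ℕ) (r : Fin m → M) (c : α → Code L M (Fin m)), a = fun i => (c i).eval r := by
  choose m r c h using fun i => exists_code (a i)
  obtain ⟨k, ⟨e⟩⟩ := Finite.exists_equiv_fin (Σ i, Fin (m i))
  refine ⟨k, fun j => r (e.symm j).1 (e.symm j).2, fun i => (c i).map fun j => e ⟨i, j⟩, ?_⟩
  funext i
  rw [Code.eval_map, h i]
  congr 1
  funext j
  rw [Function.comp_apply, Equiv.symm_apply_apply]

/-- Two tuples of elements of `M^eq` are obtained in the same way from tuples of elements of `M`
that have the same type. -/
def Conj {α : Type*} (a a' : α → Meq L M) : Prop :=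
  ∃ (m : ℕ) (r r' : Fin m → M) (c : α → Code L M (Fin m)), SameType L r r' ∧
    a = (fun i => (c i).eval r) ∧ a' = fun i => (c i).eval r'

variable {α β γ : Type*}

theorem Conj.of_codes [Finite β] {r r' : β → M} (h : SameType L r r') (c : α → Code L M β) :
    Conj (fun i => (c i).eval r) (fun i => (c i).eval r') := by
  obtain ⟨k, ⟨e⟩⟩ := Finite.exists_equiv_fin β
  refine ⟨k, r ∘ e.symm, r' ∘ e.symm, fun i => (c i).map e, h.comp _, ?_, ?_⟩ <;>
    simp [Function.comp_assoc]

theorem Conj.refl [Finite α] (a : α → Meq L M) : Conj a a := by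
  obtain ⟨m, r, c, rfl⟩ := exists_codes a
  exact ⟨m, r, r, c, .refl _, rfl, rfl⟩

theorem Conj.symm {a a' : α → Meq L M} (h : Conj a a') : Conj a' a := by
  obtain ⟨m, r, r', c, h, ha, ha'⟩ := h
  exact ⟨m, r', r, c, h.symm, ha', ha⟩

theorem Conj.comp {a a' : α → Meq L M} (h : Conj a a') (f : β → α) : Conj (a ∘ f) (a' ∘ f) := by
  obtain ⟨m, r, r', c, h, rfl, rfl⟩ := h
  exact ⟨m, r, r', c ∘ f, h, rfl, rfl⟩

theorem Conj.eq_iff {a a' : α → Meq L M} (h : Conj a a') {i j : α} : a i = a j ↔ a' i = a' j := by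
  obtain ⟨m, r, r', c, h, rfl, rfl⟩ := h
  exact Code.eval_eq_iff h

/-- Codes are not unique, so conjugacy is not visibly transitive. This allows the presentation of
one side to be prescribed: adjoin `s` to the tuple given by the conjugacy and move it by
back-and-forth; coincidences between evaluations of codes are preserved. -/
theorem Conj.exists_representative (hM : FinitelyManyTypes L M) {a : α → Meq L M} {m : ℕ}
    {s : Fin m → M} {d : α → Code L M (Fin m)} (h : Conj a fun i => (d i).eval s) :
    ∃ t, SameType L t s ∧ a = fun i => (d i).eval t := by
  obtain ⟨k, r, r', c, h, rfl, h'⟩ := h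
  obtain ⟨t, ht⟩ := hM.exists_extend h.symm s
  refine ⟨t, (ht.comp Sum.inr).symm, funext fun i => ?_⟩
  have := (Code.eval_eq_iff ht (c := (c i).map Sum.inl) (d := (d i).map Sum.inr)).1
    (by simpa using (congrFun h' i).symm)
  simpa using this

theorem Conj.trans (hM : FinitelyManyTypes L M) {a a' a'' : α → Meq L M} (h : Conj a a')
    (h' : Conj a' a'') : Conj a a'' := by
  obtain ⟨k, r, r', c, hr, rfl, rfl⟩ := h'
  obtain ⟨t, ht, rfl⟩ := h.exists_representative hM
  exact ⟨k, t, r', c, ht.trans hr, rfl, rfl⟩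

theorem Conj.exists_extend (hM : FinitelyManyTypes L M) [Finite β] {a a' : α → Meq L M}
    (h : Conj a a') (b : β → Meq L M) : ∃ b', Conj (Sum.elim a b) (Sum.elim a' b') := by
  obtain ⟨k, r, r', c, hr, rfl, rfl⟩ := h
  obtain ⟨m, s, d, rfl⟩ := exists_codes b
  obtain ⟨s', hs⟩ := hM.exists_extend hr s
  refine ⟨fun i => (d i).eval s', ?_⟩
  convert Conj.of_codes hs (Sum.elim (fun i => (c i).map Sum.inl) fun i => (d i).map Sum.inr)
    using 1 <;>
  · funext i
    cases i <;> simp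

/-! ### Conjugate tuples satisfy the same formulas -/

theorem Conj.eqRelMap {m : ℕ} {x x' : Fin m → Meq L M} (h : Conj x x') (R : EqRel L M m)
    (hR : eqRelMap L M R x) : eqRelMap L M R x' := by
  obtain ⟨k, r, r', c, hr, rfl, rfl⟩ := h
  have hreal : ∀ {i : Code L M (Fin k)} {y : M}, i.eval r = .real y → ∃ j, i = .real j ∧ r j = y := by
    rintro (j | _) y h
    · exact ⟨j, rfl, Meq.real.inj h⟩
    · exact absurd h (by simp [Code.eval])
  cases R with
  | rel R =>
    obtain ⟨y, hy, hR⟩ := hR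
    choose j hj hjy using fun i => hreal (congrFun hy i)
    refine ⟨fun i => r' (j i), funext fun i => by rw [hj]; rfl, ?_⟩
    have := hr (R.formula fun i => Language.Term.var (j i))
    simp only [Language.Formula.realize_rel, Language.Term.realize_var] at this
    refine this.1 ?_
    simpa only [hjy] using hR
  | @graph l f =>
    obtain ⟨y, hy⟩ := hR
    choose j hj hjy using fun i : Fin l => hreal (y := y i)
      (by simpa using congrFun hy i.castSucc)
    obtain ⟨j', hj', hjy'⟩ := hreal (i := c (Fin.last l)) (by simpa using congrFun hy (Fin.last l))
    refine ⟨fun i => r' (j i), funext fun i => ?_⟩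
    refine Fin.lastCases ?_ (fun i => ?_) i
    · have := hr ((Language.Term.func f fun i => Language.Term.var (j i)).equal
        (Language.Term.var j'))
      simp only [Language.Formula.realize_equal, Language.Term.realize_var,
        Language.Term.realize_func] at this
      simp only [hj', Code.eval, Fin.snoc_last]
      rw [this.1 (by simpa only [hjy] using hjy'.symm)]
    · simp only [hj, Code.eval, Fin.snoc_castSucc]
  | homeSort =>
    obtain ⟨y, hy⟩ := hR
    obtain ⟨j, hj, -⟩ := hreal hy
    exact ⟨r' j, by simp only [hj]; rfl⟩
  | sort l E =>
    obtain ⟨q, hq⟩ := hR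
    change ∃ q, (c 0).eval r' = _
    change (c 0).eval r = _ at hq
    cases hc : c 0 with
    | real => rw [hc] at hq; exact absurd hq (by simp [Code.eval])
    | imag l' E' g =>
      rw [hc] at hq
      obtain ⟨rfl, hE, -⟩ := Meq.imag.inj hq
      obtain rfl := eq_of_heq hE
      exact ⟨_, rfl⟩
  | proj l E =>
    obtain ⟨y, hy⟩ := hR
    choose j hj hjy using fun i : Fin (l + 1) => hreal (y := y i)
      (by simpa using congrFun hy i.castSucc)
    refine ⟨fun i => r' (j i), funext fun i => ?_⟩
    refine Fin.lastCases ?_ (fun i => ?_) i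
    · simp only [Fin.snoc_last]
      have h1 : (c (Fin.last _)).eval r = (Code.imag l E j).eval r := by
        have := congrFun hy (Fin.last _)
        simp only [Fin.snoc_last] at this
        rw [this, ← funext hjy]
        rfl
      exact (Code.eval_eq_iff hr).1 h1
    · simp only [hj, Code.eval, Fin.snoc_castSucc]

theorem Conj.realize_boundedFormula (hM : FinitelyManyTypes L M) {n : ℕ}
    (φ : (eqLang L M).BoundedFormula α n) {v v' : α → Meq L M} {xs xs' : Fin n → Meq L M}
    (h : Conj (Sum.elim v xs) (Sum.elim v' xs')) : φ.Realize v xs ↔ φ.Realize v' xs' := by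
  -- The language of `M^eq` has no function symbols, so its terms are variables; the quantifier case
  -- below is back-and-forth.
  have hvar : ∀ {n : ℕ} (t : (eqLang L M).Term (α ⊕ Fin n)), ∃ j, t = Language.Term.var j := by
    rintro n (j | ⟨f, _⟩)
    · exact ⟨j, rfl⟩
    · exact f.elim
  induction φ generalizing v v' with
  | falsum => exact Iff.rfl
  | equal t₁ t₂ =>
    obtain ⟨i, rfl⟩ := hvar t₁
    obtain ⟨j, rfl⟩ := hvar t₂
    exact h.eq_iff
  | rel R ts =>
    choose j hj using fun i => hvar (ts i)
    obtain rfl : ts = fun i => Language.Term.var (j i) := funext hj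
    exact ⟨(h.comp j).eqRelMap R, (h.comp j).symm.eqRelMap R⟩
  | imp φ ψ ih₁ ih₂ => exact imp_congr (ih₁ h) (ih₂ h)
  | @all n φ ih =>
    let e : α ⊕ Fin (n + 1) → (α ⊕ Fin n) ⊕ Fin 1 :=
      Sum.elim (Sum.inl ∘ Sum.inl) (Fin.snoc (α := fun _ => (α ⊕ Fin n) ⊕ Fin 1)
        (Sum.inl ∘ Sum.inr) (Sum.inr 0))
    have he : ∀ (v : α → Meq L M) (xs : Fin n → Meq L M) (b : Fin 1 → Meq L M),
        Sum.elim (Sum.elim v xs) b ∘ e = Sum.elim v (Fin.snoc xs (b 0)) := by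
      intro v xs b
      funext i
      rcases i with i | i
      · rfl
      · refine Fin.lastCases ?_ (fun i => ?_) i <;> simp [e]
    have key : ∀ {v v' : α → Meq L M} {xs xs' : Fin n → Meq L M},
        Conj (Sum.elim v xs) (Sum.elim v' xs') → (∀ x, φ.Realize v (Fin.snoc xs x)) →
        ∀ x, φ.Realize v' (Fin.snoc xs' x) := by
      intro v v' xs xs' h hφ x
      obtain ⟨b, hb⟩ := h.symm.exists_extend hM (fun _ : Fin 1 => x)
      have := hb.comp e
      rw [he, he] at this
      exact (ih this).2 (hφ _)
    exact ⟨key h, key h.symm⟩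

theorem Conj.realize (hM : FinitelyManyTypes L M) (φ : (eqLang L M).Formula α)
    {v v' : α → Meq L M} (h : Conj v v') : φ.Realize v ↔ φ.Realize v' := by
  refine Conj.realize_boundedFormula hM φ ?_
  have := h.comp (Sum.elim id Fin.elim0 : α ⊕ Fin 0 → α)
  convert this using 1 <;>
  · funext i
    rcases i with i | i
    · rfl
    · exact i.elim0

end Conjugate

/-! ### Conjugacy classes are definable in `M^eq` -/

section Definability

variable {L : FirstOrder.Language.{u, v}} {M : Type w} [L.Structure M] {α β γ : Type*}

theorem definable_eqRelMap {m : ℕ} (R : EqRel L M m) (f : Fin m → α) :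
    (∅ : Set (Meq L M)).Definable (eqLang L M) {x : α → Meq L M | eqRelMap L M R (x ∘ f)} := by
  refine Set.empty_definable_iff.2
    ⟨Language.Relations.formula (L := eqLang L M) R fun i => Language.Term.var (f i), ?_⟩
  ext x
  rfl

theorem definable_eq (i j : α) :
    (∅ : Set (Meq L M)).Definable (eqLang L M) {x : α → Meq L M | x i = x j} := by
  refine Set.empty_definable_iff.2 ⟨(Language.Term.var i).equal (Language.Term.var j), ?_⟩
  ext x
  simp

/-- The image in `M^eq` of a set of tuples of elements of `M`. -/
def realSet (D : Set (α → M)) : Set (α → Meq L M) :=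
  {x | ∃ y ∈ D, x = fun i => Meq.real (y i)}

theorem mem_realSet {D : Set (α → M)} {y : α → M} :
    (fun i => Meq.real (L := L) (y i)) ∈ realSet D ↔ y ∈ D := by
  refine ⟨?_, fun h => ⟨y, h, rfl⟩⟩
  rintro ⟨z, hz, h⟩
  rwa [show y = z from funext fun i => Meq.real.inj (congrFun h i)]

theorem definable_realSet_univ [Finite α] :
    (∅ : Set (Meq L M)).Definable (eqLang L M) (realSet (Set.univ : Set (α → M))) := by
  have := Set.definable_iInter_of_finite fun i : α =>
    definable_eqRelMap (L := L) (M := M) .homeSort (fun _ => i)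
  convert! this using 1
  ext x
  simp only [Set.mem_iInter]
  constructor
  · rintro ⟨y, -, rfl⟩ i
    exact ⟨y i, rfl⟩
  · intro h
    choose y hy using h
    exact ⟨y, trivial, funext hy⟩

/-- Functions of `L` survive in `M^eq` only as graphs, so a term is unfolded by quantifying over the
values of its subterms. -/
theorem definable_realSet_term [Finite α] (t : L.Term α) :
    (∅ : Set (Meq L M)).Definable (eqLang L M)
      (realSet {z : α ⊕ Fin 1 → M | z (Sum.inr 0) = t.realize (z ∘ Sum.inl)}) := by
  induction t with
  | var i =>
    convert! (definable_realSet_univ (L := L) (M := M) (α := α ⊕ Fin 1)).inter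
      (definable_eq (Sum.inr 0) (Sum.inl i)) using 1
    ext x
    constructor
    · rintro ⟨y, hy, rfl⟩
      exact ⟨⟨y, trivial, rfl⟩, congrArg Meq.real hy⟩
    · rintro ⟨⟨y, -, rfl⟩, hy⟩
      exact ⟨y, Meq.real.inj hy, rfl⟩
  | @func l f ts ih =>
    have h1 := fun i => (ih i).preimage_comp
      (Sum.elim (Sum.inl ∘ Sum.inl) (fun _ => Sum.inr i) : α ⊕ Fin 1 → (α ⊕ Fin 1) ⊕ Fin l)
    have h2 := definable_eqRelMap (L := L) (M := M) (.graph f)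
      (Fin.snoc (α := fun _ => (α ⊕ Fin 1) ⊕ Fin l) Sum.inr (Sum.inl (Sum.inr 0)))
    convert! (definable_realSet_univ (L := L) (M := M) (α := α ⊕ Fin 1)).inter
      ((Set.definable_iInter_of_finite h1).inter h2).exists_of_finite using 1
    ext x
    constructor
    · rintro ⟨y, hy, rfl⟩
      refine ⟨⟨y, trivial, rfl⟩, fun i => Meq.real ((ts i).realize (y ∘ Sum.inl)), ?_, ?_⟩
      · simp only [Set.mem_iInter]
        refine fun i => ⟨Sum.elim (y ∘ Sum.inl) fun _ => (ts i).realize (y ∘ Sum.inl), rfl, ?_⟩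
        funext j
        rcases j with j | j <;> rfl
      · refine ⟨fun i => (ts i).realize (y ∘ Sum.inl), funext fun j => ?_⟩
        refine Fin.lastCases ?_ (fun j => ?_) j
        · simpa using hy
        · simp
    · rintro ⟨⟨y, -, rfl⟩, w, hw, z, hz⟩
      simp only [Set.mem_iInter] at hw
      refine ⟨y, ?_, rfl⟩
      have hw' : ∀ i, w i = Meq.real ((ts i).realize (y ∘ Sum.inl)) := fun i => by
        obtain ⟨y', hy', h⟩ := hw i
        have hr : y' (Sum.inr 0) = (ts i).realize (y' ∘ Sum.inl) := hy'
        have hl : y' ∘ Sum.inl = y ∘ Sum.inl :=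
          funext fun j => (Meq.real.inj (congrFun h (Sum.inl j))).symm
        rw [← hl, ← hr]
        exact congrFun h (Sum.inr 0)
      have hz' : ∀ i, z i = (ts i).realize (y ∘ Sum.inl) := fun i => by
        have := congrFun hz i.castSucc
        simp only [Function.comp_apply, Fin.snoc_castSucc, Sum.elim_inr, hw'] at this
        exact (Meq.real.inj this).symm
      have := congrFun hz (Fin.last _)
      simp only [Function.comp_apply, Fin.snoc_last, Sum.elim_inl] at this
      rw [funext hz'] at this
      exact Meq.real.inj this

/-- Formulas of `L` are translated by relativizing quantifiers to the home sort. -/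
theorem definable_realSet_boundedFormula [Finite α] {n : ℕ} (φ : L.BoundedFormula α n) :
    (∅ : Set (Meq L M)).Definable (eqLang L M)
      (realSet {z : α ⊕ Fin n → M | φ.Realize (z ∘ Sum.inl) (z ∘ Sum.inr)}) := by
  induction φ with
  | falsum =>
    convert! Set.definable_empty using 1
    ext x
    constructor
    · rintro ⟨y, hy, -⟩
      exact hy
    · exact fun h => h.elim
  | @equal n t₁ t₂ =>
    convert! ((definable_realSet_term t₁).inter (definable_realSet_term t₂)).exists_of_finite using 1
    ext x
    constructor
    · rintro ⟨y, hy, rfl⟩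
      have hy' : t₁.realize y = t₂.realize y := by
        have : t₁.realize (Sum.elim (y ∘ Sum.inl) (y ∘ Sum.inr)) =
          t₂.realize (Sum.elim (y ∘ Sum.inl) (y ∘ Sum.inr)) := hy
        rwa [Sum.elim_comp_inl_inr] at this
      refine ⟨fun _ => Meq.real (t₁.realize y), ⟨Sum.elim y fun _ => t₁.realize y, rfl, ?_⟩,
        ⟨Sum.elim y fun _ => t₁.realize y, hy', ?_⟩⟩ <;>
      · funext j
        rcases j with j | j <;> rfl
    · rintro ⟨w, ⟨y, hy, h⟩, ⟨y', hy', h'⟩⟩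
      obtain rfl : y = y' := funext fun i => Meq.real.inj (congrFun (h.symm.trans h') i)
      refine ⟨y ∘ Sum.inl, ?_, funext fun i => congrFun h (Sum.inl i)⟩
      change t₁.realize _ = t₂.realize _
      rw [Sum.elim_comp_inl_inr (y ∘ Sum.inl)]
      exact hy.symm.trans hy'
  | @rel n l R ts =>
    have h1 := fun i => (definable_realSet_term (M := M) (ts i)).preimage_comp
      (Sum.elim Sum.inl (fun _ => Sum.inr i) : (α ⊕ Fin n) ⊕ Fin 1 → (α ⊕ Fin n) ⊕ Fin l)
    have h2 := definable_eqRelMap (L := L) (M := M) (.rel R)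
      (Sum.inr : Fin l → (α ⊕ Fin n) ⊕ Fin l)
    convert! (definable_realSet_univ (L := L) (M := M) (α := α ⊕ Fin n)).inter
      ((Set.definable_iInter_of_finite h1).inter h2).exists_of_finite using 1
    ext x
    constructor
    · rintro ⟨y, hy, rfl⟩
      have hy' : Language.Structure.RelMap R fun i => (ts i).realize y := by
        have : Language.Structure.RelMap R fun i => (ts i).realize
          (Sum.elim (y ∘ Sum.inl) (y ∘ Sum.inr)) := hy
        rwa [Sum.elim_comp_inl_inr] at this
      refine ⟨⟨y, trivial, rfl⟩, fun i => Meq.real ((ts i).realize y), ?_, _, rfl, hy'⟩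
      simp only [Set.mem_iInter]
      refine fun i => ⟨Sum.elim y fun _ => (ts i).realize y, rfl, ?_⟩
      funext j
      rcases j with j | j <;> rfl
    · rintro ⟨⟨y, -, rfl⟩, w, hw, z, hz, hR⟩
      simp only [Set.mem_iInter] at hw
      refine ⟨y, ?_, rfl⟩
      have hz' : ∀ i, z i = (ts i).realize y := fun i => by
        obtain ⟨y', hy', h⟩ := hw i
        have hr : y' (Sum.inr 0) = (ts i).realize (y' ∘ Sum.inl) := hy'
        have hl : y' ∘ Sum.inl = y :=
          funext fun j => (Meq.real.inj (congrFun h (Sum.inl j))).symm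
        rw [← hl, ← hr]
        exact Meq.real.inj ((congrFun hz i).symm.trans (congrFun h (Sum.inr 0)))
      change Language.Structure.RelMap R fun i => (ts i).realize _
      rw [Sum.elim_comp_inl_inr, ← funext hz']
      exact hR
  | @imp n φ ψ ih₁ ih₂ =>
    convert! (definable_realSet_univ (L := L) (M := M) (α := α ⊕ Fin n)).inter
      (ih₁.compl.union ih₂) using 1
    ext x
    constructor
    · rintro ⟨y, hy, rfl⟩
      refine ⟨⟨y, trivial, rfl⟩, ?_⟩
      rw [Set.mem_union, Set.mem_compl_iff, mem_realSet, mem_realSet]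
      exact imp_iff_not_or.1 hy
    · rintro ⟨⟨y, -, rfl⟩, hy⟩
      rw [Set.mem_union, Set.mem_compl_iff, mem_realSet, mem_realSet] at hy
      exact ⟨y, imp_iff_not_or.2 hy, rfl⟩
  | @all n φ ih =>
    let e : α ⊕ Fin (n + 1) → (α ⊕ Fin n) ⊕ Fin 1 :=
      Sum.elim (Sum.inl ∘ Sum.inl) (Fin.snoc (α := fun _ => (α ⊕ Fin n) ⊕ Fin 1)
        (Sum.inl ∘ Sum.inr) (Sum.inr 0))
    have he : ∀ {X : Type w} (y : α ⊕ Fin n → X) (b : Fin 1 → X),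
        Sum.elim y b ∘ e = Sum.elim (y ∘ Sum.inl) (Fin.snoc (y ∘ Sum.inr) (b 0)) := by
      intro X y b
      funext i
      rcases i with i | i
      · rfl
      · refine Fin.lastCases ?_ (fun i => ?_) i <;> simp [e]
    have hreal : ∀ (y : α ⊕ Fin n → M) (a : M),
        Sum.elim (fun i => Meq.real (L := L) (y i)) (fun _ : Fin 1 => Meq.real a) ∘ e =
          fun i => Meq.real ((Sum.elim (y ∘ Sum.inl) (Fin.snoc (y ∘ Sum.inr) a) :
            α ⊕ Fin (n + 1) → M) i) := by
      intro y a
      rw [← he y fun _ => a]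
      funext i
      simp only [Function.comp_apply]
      rcases e i with j | j <;> rfl
    have h1 := (definable_realSet_univ (L := L) (M := M) (α := Fin 1)).preimage_comp
      (Sum.inr : Fin 1 → (α ⊕ Fin n) ⊕ Fin 1)
    convert! (definable_realSet_univ (L := L) (M := M) (α := α ⊕ Fin n)).inter
      (h1.inter (ih.preimage_comp e).compl).exists_of_finite.compl using 1
    ext x
    constructor
    · rintro ⟨y, hy, rfl⟩
      refine ⟨⟨y, trivial, rfl⟩, ?_⟩
      rintro ⟨w, ⟨a, -, ha⟩, hw⟩
      obtain rfl : w = fun i => Meq.real (a i) := ha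
      refine hw ?_
      rw [Set.mem_preimage, show a = fun _ => a 0 from funext fun i => by
        rw [Subsingleton.elim i 0], hreal, mem_realSet]
      exact hy (a 0)
    · rintro ⟨⟨y, -, rfl⟩, hy⟩
      refine ⟨y, fun a => ?_, rfl⟩
      by_contra hc
      refine hy ⟨fun _ => Meq.real a, ⟨fun _ => a, trivial, rfl⟩, ?_⟩
      rw [Set.mem_compl_iff, Set.mem_preimage, hreal, mem_realSet]
      exact hc

theorem definable_realSet [Finite α] {D : Set (α → M)} (hD : (∅ : Set M).Definable L D) :
    (∅ : Set (Meq L M)).Definable (eqLang L M) (realSet D) := by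
  obtain ⟨φ, rfl⟩ := Set.empty_definable_iff.1 hD
  convert! (definable_realSet_boundedFormula (M := M) φ).image_comp (Sum.inl : α → α ⊕ Fin 0) using 1
  ext x
  constructor
  · rintro ⟨y, hy, rfl⟩
    refine ⟨fun i => Meq.real ((Sum.elim y Fin.elim0 : α ⊕ Fin 0 → M) i), ⟨_, ?_, rfl⟩, rfl⟩
    change Language.BoundedFormula.Realize φ y _
    rwa [Subsingleton.elim ((Sum.elim y Fin.elim0 : α ⊕ Fin 0 → M) ∘ Sum.inr) default]
  · rintro ⟨_, ⟨y, hy, rfl⟩, rfl⟩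
    refine ⟨y ∘ Sum.inl, ?_, rfl⟩
    change Language.BoundedFormula.Realize φ _ _ at hy
    rwa [Subsingleton.elim (y ∘ Sum.inr) default] at hy

theorem definable_eval [Finite β] (c : Code L M β) :
    (∅ : Set (Meq L M)).Definable (eqLang L M)
      {z : β ⊕ Fin 1 → Meq L M | ∃ y : β → M, z = Sum.elim (fun i => .real (y i)) fun _ => c.eval y} := by
  have h1 := (definable_realSet_univ (L := L) (M := M) (α := β)).preimage_comp
      (Sum.inl : β → β ⊕ Fin 1)
  cases c with
  | real j =>
    convert! h1.inter (definable_eq (Sum.inr 0) (Sum.inl j)) using 1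
    ext x
    constructor
    · rintro ⟨y, rfl⟩
      exact ⟨⟨y, trivial, rfl⟩, rfl⟩
    · rintro ⟨⟨y, -, h⟩, hy⟩
      refine ⟨y, funext fun i => ?_⟩
      rcases i with i | i
      · exact congrFun h i
      · rw [Subsingleton.elim i 0]
        exact hy.trans (congrFun h j)
  | imag k E f =>
    convert! h1.inter (definable_eqRelMap (.proj k E)
      (Fin.snoc (α := fun _ => β ⊕ Fin 1) (Sum.inl ∘ f) (Sum.inr 0))) using 1
    ext x
    constructor
    · rintro ⟨y, rfl⟩
      refine ⟨⟨y, trivial, rfl⟩, y ∘ f, funext fun i => ?_⟩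
      refine Fin.lastCases ?_ (fun i => ?_) i
      · simp [Code.eval]
      · simp
    · rintro ⟨⟨y, -, h⟩, z, hz⟩
      refine ⟨y, funext fun i => ?_⟩
      rcases i with i | i
      · exact congrFun h i
      · have hz' : z = y ∘ f := funext fun j => by
          have := congrFun hz j.castSucc
          simp only [Function.comp_apply, Fin.snoc_castSucc] at this
          exact Meq.real.inj (this.symm.trans (congrFun h (f j)))
        have := congrFun hz (Fin.last _)
        simp only [Function.comp_apply, Fin.snoc_last] at this
        rw [Subsingleton.elim i 0, this, hz']
        rfl

/-- With codes `c` and a real tuple `r` presenting `a`, the conjugates of `a` are the values of `c`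
at the tuples of the type of `r`. -/
theorem definable_conj (hM : FinitelyManyTypes L M) [Finite α] (a : α → Meq L M) :
    (∅ : Set (Meq L M)).Definable (eqLang L M) {a' | Conj a a'} := by
  obtain ⟨m, r, c, rfl⟩ := exists_codes a
  have h1 := (definable_realSet (hM.definable_sameType r)).preimage_comp
    (Sum.inr : Fin m → α ⊕ Fin m)
  have h2 := fun i => (definable_eval (c i)).preimage_comp
    (Sum.elim Sum.inr (fun _ => Sum.inl i) : Fin m ⊕ Fin 1 → α ⊕ Fin m)
  convert! (h1.inter (Set.definable_iInter_of_finite h2)).exists_of_finite using 1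
  ext a'
  constructor
  · intro h
    obtain ⟨t, ht, rfl⟩ := Conj.exists_representative hM (Conj.symm h)
    refine ⟨fun i => .real (t i), ⟨t, ht.symm, rfl⟩, ?_⟩
    simp only [Set.mem_iInter]
    refine fun i => ⟨t, funext fun j => ?_⟩
    rcases j with j | j <;> rfl
  · rintro ⟨u, ⟨t, ht, hu⟩, h⟩
    obtain rfl : u = fun i => .real (t i) := hu
    simp only [Set.mem_iInter] at h
    have : a' = fun i => (c i).eval t := funext fun i => by
      obtain ⟨y, hy⟩ := h i
      obtain rfl : t = y := funext fun j => Meq.real.inj (congrFun hy (Sum.inl j))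
      exact congrFun hy (Sum.inr 0)
    rw [this]
    exact Conj.of_codes ht c

theorem definable_conj_params (hM : FinitelyManyTypes L M) [Finite α] {A F : Set (Meq L M)}
    (hF : F.Finite) (hFA : F ⊆ A) (a : α → Meq L M) :
    A.Definable (eqLang L M)
      {a' | Conj (Sum.elim a (Subtype.val : F → Meq L M)) (Sum.elim a' Subtype.val)} := by
  have := hF.to_subtype
  have h1 := (definable_conj hM (Sum.elim a (Subtype.val : F → Meq L M))).mono (Set.empty_subset A)
  have h2 := Set.definable_iInter_of_finite fun f : F =>
    definable_coord_eq (L := eqLang L M) (hFA f.2) (Sum.inr f : α ⊕ F)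
  convert! (h1.inter h2).exists_of_finite using 1
  ext a'
  constructor
  · intro h
    refine ⟨Subtype.val, h, ?_⟩
    simp only [Set.mem_iInter]
    exact fun _ => rfl
  · rintro ⟨u, h, hu⟩
    simp only [Set.mem_iInter] at hu
    obtain rfl : u = Subtype.val := funext hu
    exact h

/-- A set definable over `A` is invariant under conjugacy over some finite subset of `A`. -/
theorem exists_finite_support (hM : FinitelyManyTypes L M) {A : Set (Meq L M)}
    {D : Set (α → Meq L M)} (hD : A.Definable (eqLang L M) D) :
    ∃ F ⊆ A, F.Finite ∧ ∀ a a' : α → Meq L M,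
      Conj (Sum.elim a (Subtype.val : F → Meq L M)) (Sum.elim a' Subtype.val) → a ∈ D → a' ∈ D := by
  obtain ⟨F, hFA, hF⟩ := Set.definable_iff_finitely_definable.1 hD
  obtain ⟨φ, rfl⟩ := Set.definable_iff_exists_formula_sum.1 hF
  refine ⟨F, hFA, F.finite_toSet, fun a a' h ha => ?_⟩
  have h' := h.comp (Sum.swap : (F : Set (Meq L M)) ⊕ α → _)
  have := (h'.realize hM φ).1
  rw [Sum.elim_swap, Sum.elim_swap] at this
  exact this ha

end Definability

/-! ### Equality of types and algebraic closure in `M^eq` -/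

section AlgebraicClosure

variable {L : FirstOrder.Language.{u, v}} {M : Type w} [L.Structure M] {α β γ : Type*}

/-- The conjugates of `a` over the finite tuple `u`. -/
def orbit (u : α → Meq L M) (a : Meq L M) : Set (Meq L M) :=
  {x | Conj (Sum.elim (fun _ : Fin 1 => a) u) (Sum.elim (fun _ => x) u)}

theorem orbit_subset_comp (u : α → Meq L M) (f : β → α) (a : Meq L M) :
    orbit u a ⊆ orbit (u ∘ f) a := fun x hx => by
  have := Conj.comp hx (Sum.map id f)
  rwa [Sum.elim_comp_map, Sum.elim_comp_map] at this

/-- If the orbit of `a'` were larger than that of `a`, one element too many could be carried back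
along the conjugacy, injectively, into the orbit of `a`. -/
theorem finite_orbit_of_conj (hM : FinitelyManyTypes L M) [Finite α] {u u' : α → Meq L M}
    {a a' : Meq L M} (h : Conj (Sum.elim (fun _ : Fin 1 => a) u) (Sum.elim (fun _ => a') u'))
    (ha : (orbit u a).Finite) : (orbit u' a').Finite := by
  by_contra hinf
  obtain ⟨t, ht, htc⟩ := Set.Infinite.exists_subset_card_eq hinf ((orbit u a).ncard + 1)
  obtain ⟨y, hy⟩ := (h.comp Sum.inr).symm.exists_extend hM (Subtype.val : t → Meq L M)
  rw [Sum.elim_comp_inr, Sum.elim_comp_inr] at hy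
  have hmem : ∀ i : t, y i ∈ orbit u a := fun i => by
    have h1 := hy.comp (Sum.elim (fun _ => Sum.inr i) Sum.inl : Fin 1 ⊕ α → α ⊕ t)
    rw [Sum.comp_elim, Sum.comp_elim, Sum.elim_comp_inl, Sum.elim_comp_inl] at h1
    exact (h.trans hM (ht i.2)).trans hM h1
  have hinj : Function.Injective y := fun i j hij =>
    Subtype.ext ((hy.eq_iff (i := Sum.inr i) (j := Sum.inr j)).2 hij)
  have h1 := Set.ncard_le_ncard (Set.range_subset_iff.2 hmem) ha
  rw [Set.ncard_range_of_injective hinj, Nat.card_eq_fintype_card, Fintype.card_coe, htc] at h1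
  omega

theorem mem_aclEq_iff (hM : FinitelyManyTypes L M) {A : Set (Meq L M)} {a : Meq L M} :
    a ∈ aclEq A ↔ ∃ F ⊆ A, F.Finite ∧ (orbit (Subtype.val : F → Meq L M) a).Finite := by
  constructor
  · rintro ⟨D, hD, hDf, ha⟩
    obtain ⟨F, hFA, hF, hinv⟩ := exists_finite_support hM hD
    exact ⟨F, hFA, hF, hDf.subset fun x hx => hinv _ _ hx ha⟩
  · rintro ⟨F, hFA, hF, hO⟩
    have := hF.to_subtype
    refine ⟨_, ?_, hO, Conj.refl _⟩
    unfold Set.Definable₁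
    convert! definable_conj_params hM hF hFA (fun _ : Fin 1 => a) using 1
    ext x
    rw [show x = fun _ => x 0 from funext fun i => by rw [Subsingleton.elim i 0] ]
    rfl

theorem mem_aclEq_range_iff (hM : FinitelyManyTypes L M) [Finite α] {u : α → Meq L M}
    {a : Meq L M} : a ∈ aclEq (Set.range u) ↔ (orbit u a).Finite := by
  rw [mem_aclEq_iff hM]
  constructor
  · rintro ⟨F, hF, -, h⟩
    choose f hf using fun x : F => hF x.2
    refine h.subset ?_
    rw [show (Subtype.val : F → Meq L M) = u ∘ f from funext fun x => (hf x).symm]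
    exact orbit_subset_comp u f a
  · intro h
    exact ⟨_, subset_rfl, Set.finite_range u,
      h.subset (orbit_subset_comp Subtype.val (Set.rangeFactorization u) a)⟩

theorem mem_aclEq_finite_iff (hM : FinitelyManyTypes L M) {F : Set (Meq L M)} (hF : F.Finite)
    {a : Meq L M} : a ∈ aclEq F ↔ (orbit (Subtype.val : F → Meq L M) a).Finite := by
  have := hF.to_subtype
  have h := mem_aclEq_range_iff hM (u := (Subtype.val : F → Meq L M)) (a := a)
  rwa [Subtype.range_val] at h

theorem aclEq_mono {A B : Set (Meq L M)} (h : A ⊆ B) : aclEq A ⊆ aclEq B := by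
  rintro a ⟨D, hD, hf, ha⟩
  exact ⟨D, Set.Definable.mono hD h, hf, ha⟩

theorem exists_finite_of_mem_aclEq (hM : FinitelyManyTypes L M) {A : Set (Meq L M)} {a : Meq L M}
    (h : a ∈ aclEq A) : ∃ F ⊆ A, F.Finite ∧ a ∈ aclEq F := by
  obtain ⟨F, hFA, hF, hO⟩ := (mem_aclEq_iff hM).1 h
  exact ⟨F, hFA, hF, (mem_aclEq_finite_iff hM hF).2 hO⟩

theorem subset_aclEq (A : Set (Meq L M)) : A ⊆ aclEq A := fun a ha =>
  ⟨{a}, Set.Definable.singleton_of_mem _ ha, Set.finite_singleton a, rfl⟩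

/-- Let `b` be algebraic over a finite `F` whose elements are algebraic over a finite `H`. A
conjugate of `b` over `H` comes with a conjugate `y` of `F`; there are finitely many `y`, and
finitely many conjugates of `b` for each. -/
theorem aclEq_subset_of_subset (hM : FinitelyManyTypes L M) {A X : Set (Meq L M)}
    (hX : X ⊆ aclEq A) : aclEq X ⊆ aclEq A := by
  intro b hb
  obtain ⟨F, hFX, hF, hO⟩ := (mem_aclEq_iff hM).1 hb
  have := hF.to_subtype
  choose! G hGA hG hGO using fun f (hf : f ∈ F) => exists_finite_of_mem_aclEq hM (hX (hFX hf))
  let H : Set (Meq L M) := ⋃ f ∈ F, G f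
  have hH : H.Finite := hF.biUnion hG
  have := hH.to_subtype
  have hHF : ∀ f : F, (orbit (Subtype.val : H → Meq L M) f.1).Finite := fun f =>
    (mem_aclEq_finite_iff hM hH).1 (aclEq_mono (Set.subset_biUnion_of_mem f.2) (hGO f.1 f.2))
  refine aclEq_mono (Set.iUnion₂_subset hGA) ((mem_aclEq_finite_iff hM hH).2 ?_)
  refine ((Set.Finite.pi hHF).biUnion (t := fun y => {b' | Conj
    (Sum.elim (fun _ : Fin 1 => b) (Subtype.val : F → Meq L M)) (Sum.elim (fun _ => b') y)})
    fun y _ => ?_).subset fun x hx => ?_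
  · rcases Set.eq_empty_or_nonempty {b' | Conj
      (Sum.elim (fun _ : Fin 1 => b) (Subtype.val : F → Meq L M)) (Sum.elim (fun _ => b') y)}
      with h | ⟨b₀, hb₀⟩
    · rw [h]
      exact Set.finite_empty
    · exact (finite_orbit_of_conj hM hb₀ hO).subset fun b' hb' => (Conj.symm hb₀).trans hM hb'
  · obtain ⟨y, hy⟩ := Conj.exists_extend hM hx (Subtype.val : F → Meq L M)
    refine Set.mem_biUnion (x := y) ?_ ?_
    · intro f _
      have h1 := hy.comp (Sum.elim (fun _ => Sum.inr f) (Sum.inl ∘ Sum.inr) :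
        Fin 1 ⊕ H → (Fin 1 ⊕ H) ⊕ F)
      rwa [Sum.comp_elim, Sum.comp_elim] at h1
    · have h1 := hy.comp (Sum.map Sum.inl id : Fin 1 ⊕ F → (Fin 1 ⊕ H) ⊕ F)
      rwa [Sum.elim_comp_map, Sum.elim_comp_map] at h1

theorem aclEq_union_subset (hM : FinitelyManyTypes L M) {A B B' : Set (Meq L M)}
    (h : B ⊆ aclEq B') : aclEq (A ∪ B) ⊆ aclEq (A ∪ B') :=
  aclEq_subset_of_subset hM (Set.union_subset
    (Set.subset_union_left.trans (subset_aclEq _)) (h.trans (aclEq_mono Set.subset_union_right)))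

/-! ### Equality of types of possibly infinite tuples -/

/-- The tuples `a` and `a'` have the same type in `M^eq`. -/
def EqTp (a a' : α → Meq L M) : Prop :=
  ∀ (m : ℕ) (j : Fin m → α), Conj (a ∘ j) (a' ∘ j)

theorem EqTp.conj {a a' : α → Meq L M} (h : EqTp a a') [Finite β] (f : β → α) :
    Conj (a ∘ f) (a' ∘ f) := by
  obtain ⟨k, ⟨e⟩⟩ := Finite.exists_equiv_fin β
  have := (h k (f ∘ e.symm)).comp e
  simpa [Function.comp_assoc] using this

theorem eqTp_iff_conj [Finite α] {a a' : α → Meq L M} : EqTp a a' ↔ Conj a a' :=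
  ⟨fun h => h.conj id, fun h _ j => h.comp j⟩

theorem EqTp.refl (a : α → Meq L M) : EqTp a a := fun _ _ => Conj.refl _

theorem EqTp.symm {a a' : α → Meq L M} (h : EqTp a a') : EqTp a' a := fun m j => (h m j).symm

theorem EqTp.comp {a a' : α → Meq L M} (h : EqTp a a') (f : β → α) : EqTp (a ∘ f) (a' ∘ f) :=
  fun m j => h m (f ∘ j)

theorem EqTp.mem_aclEq (hM : FinitelyManyTypes L M) {a a' : α → Meq L M} (h : EqTp a a') {i : α}
    {S : Set α} (hi : a i ∈ aclEq (a '' S)) : a' i ∈ aclEq (a' '' S) := by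
  obtain ⟨F, hFS, hF, hiF⟩ := exists_finite_of_mem_aclEq hM hi
  have := hF.to_subtype
  choose s hsS hs using fun x : F => hFS x.2
  have hFr : F = Set.range (a ∘ s) := by
    rw [show a ∘ s = Subtype.val from funext hs, Subtype.range_val]
  rw [hFr] at hiF
  have hsub : Set.range (a' ∘ s) ⊆ a' '' S := by
    rintro _ ⟨x, rfl⟩
    exact ⟨s x, hsS x, rfl⟩
  refine aclEq_mono hsub ((mem_aclEq_range_iff hM).2
    (finite_orbit_of_conj hM ?_ ((mem_aclEq_range_iff hM).1 hiF)))
  have := h.conj (Sum.elim (fun _ => i) s : Fin 1 ⊕ F → α)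
  rwa [Sum.comp_elim, Sum.comp_elim] at this

/-! ### The levels `M_n` and finiteness of `acl^n` -/

theorem mem_level_real (n : ℕ) (y : M) : Meq.real y ∈ level L M n := by
  induction n with
  | zero => exact ⟨y, rfl⟩
  | succ n ih => exact Or.inl ih

theorem mem_level_imag {n k : ℕ} {E : DefEquiv L M (k + 1)} {q : Quotient E.rel} :
    Meq.imag k E q ∈ level L M n ↔ k < n := by
  induction n with
  | zero => simp [level]
  | succ n ih =>
    simp only [level, Set.mem_union, ih]
    constructor
    · rintro (h | ⟨E', q', h⟩)
      · omega
      · obtain ⟨rfl, -⟩ := Meq.imag.inj h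
        omega
    · intro h
      rcases Nat.lt_succ_iff_lt_or_eq.1 h with h | rfl
      · exact Or.inl h
      · exact Or.inr ⟨E, q, rfl⟩

theorem Conj.mem_level {a a' : α → Meq L M} (h : Conj a a') {i : α} {n : ℕ}
    (hi : a i ∈ level L M n) : a' i ∈ level L M n := by
  obtain ⟨m, r, r', c, -, rfl, rfl⟩ := h
  dsimp only at hi ⊢
  cases hc : c i with
  | real j => exact mem_level_real n _
  | imag k E f =>
    rw [hc] at hi
    exact mem_level_imag.2 (mem_level_imag.1 hi)

theorem EqTp.mem_level {a a' : α → Meq L M} (h : EqTp a a') {i : α} {n : ℕ}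
    (hi : a i ∈ level L M n) : a' i ∈ level L M n :=
  (h 1 fun _ => i).mem_level (i := 0) hi

theorem EqTp.mem_acl_iff (hM : FinitelyManyTypes L M) {a a' : α → Meq L M} (h : EqTp a a') {i : α}
    {S : Set α} {n : ℕ} : a i ∈ acl n (a '' S) ↔ a' i ∈ acl n (a' '' S) :=
  ⟨fun hi => ⟨h.mem_aclEq hM hi.1, h.mem_level hi.2⟩,
    fun hi => ⟨h.symm.mem_aclEq hM hi.1, h.symm.mem_level hi.2⟩⟩

theorem finite_defEquiv (hM : FinitelyManyTypes L M) (k : ℕ) : Finite (DefEquiv L M k) := by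
  have := (hM.finite_definable (Fin k ⊕ Fin k)).to_subtype
  refine Finite.of_injective (β := {D : Set (Fin k ⊕ Fin k → M) | (∅ : Set M).Definable L D})
    (fun E => ⟨_, E.definable⟩) fun E E' h => ?_
  have h' := Subtype.ext_iff.1 h
  have hr : E.rel = E'.rel := Setoid.ext fun x y => by
    have := Set.ext_iff.1 h' (Sum.elim x y)
    exact this
  cases E
  cases E'
  congr

/-- Let `t` be a real tuple presenting `F`. The elements `c.eval r` are sorted by the type of `r`
together with `t`: there are finitely many types, and elements with the same one are conjugate over
`F`, hence lie in one finite orbit. -/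
theorem finite_aclEq_eval (hM : FinitelyManyTypes L M) {F : Set (Meq L M)} (hF : F.Finite)
    [Finite β] (c : Code L M β) : {a ∈ aclEq F | ∃ r : β → M, a = c.eval r}.Finite := by
  have := hF.to_subtype
  obtain ⟨m, t, d, hd⟩ := exists_codes (Subtype.val : F → Meq L M)
  obtain ⟨S, hS, hS'⟩ := hM.exists_finite_representatives (β ⊕ Fin m)
  refine (hS.biUnion (t := fun s => {a ∈ aclEq F | ∃ r : β → M, a = c.eval r ∧
    SameType L s (Sum.elim r t)}) fun s _ => ?_).subset ?_
  · rcases Set.eq_empty_or_nonempty {a ∈ aclEq F | ∃ r : β → M, a = c.eval r ∧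
      SameType L s (Sum.elim r t)} with h | ⟨a₀, ha₀, r₀, rfl, hr₀⟩
    · rw [h]
      exact Set.finite_empty
    · refine ((mem_aclEq_finite_iff hM hF).1 ha₀).subset ?_
      rintro _ ⟨-, r, rfl, hr⟩
      have := Conj.of_codes (hr₀.symm.trans hr)
        (Sum.elim (fun _ => c.map Sum.inl) (fun f => (d f).map Sum.inr) : Fin 1 ⊕ F → _)
      change Conj _ _
      rw [hd]
      convert! this using 1 <;>
      · funext i
        rcases i with i | i <;> simp
  · rintro _ ⟨ha, r, rfl⟩
    obtain ⟨s, hs, hsr⟩ := hS' (Sum.elim r t)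
    exact Set.mem_biUnion hs ⟨ha, r, rfl, hsr⟩

theorem finite_acl (hM : FinitelyManyTypes L M) (n : ℕ) {F : Set (Meq L M)} (hF : F.Finite) :
    (acl n F).Finite := by
  have := fun k => finite_defEquiv hM (k + 1)
  refine ((finite_aclEq_eval hM hF (Code.real (0 : Fin 1))).union
    (Set.finite_iUnion fun k : Fin n => Set.finite_iUnion fun E : DefEquiv L M (k + 1) =>
      finite_aclEq_eval hM hF (Code.imag k E id))).subset ?_
  rintro a ⟨ha, han⟩
  cases a with
  | real y => exact Or.inl ⟨ha, fun _ => y, rfl⟩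
  | imag k E q =>
    obtain ⟨r, rfl⟩ := Quotient.exists_rep q
    refine Or.inr ?_
    simp only [Set.mem_iUnion]
    exact ⟨⟨k, mem_level_imag.1 han⟩, E, ha, r, rfl⟩

end AlgebraicClosure

/-! ### The rank of a finite set -/

section Rank

variable {L : FirstOrder.Language.{u, v}} {M : Type w} [L.Structure M] {n : ℕ}
  {A A' B B' C D : Set (Meq L M)}

theorem acl_subset_acl (hM : FinitelyManyTypes L M) (h : A ⊆ aclEq B) : acl n A ⊆ acl n B :=
  Set.inter_subset_inter_left _ (aclEq_subset_of_subset hM h)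

theorem subset_acl (h : A ⊆ level L M n) : A ⊆ acl n A := fun _ ha => ⟨subset_aclEq _ ha, h ha⟩

theorem rankGE_succ_iff {α : Ordinal.{w}} : RankGE n A B (Order.succ α) ↔
    ∃ a ∈ acl n A \ acl n B, RankGE n A ({a} ∪ B) α := by
  refine ⟨fun h => ?_, fun ⟨a, ha, h⟩ => .succ B α a ha h⟩
  generalize e : Order.succ α = γ at h
  cases h with
  | zero => exact absurd e (Order.succ_ne_bot α)
  | succ _ β a ha h =>
    rw [Order.succ_injective e]
    exact ⟨a, ha, h⟩
  | limit _ _ hα => exact absurd (e ▸ hα) (Order.not_isSuccLimit_succ _)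

theorem rankGE_nat_succ_iff {k : ℕ} : RankGE n A B ((k + 1 : ℕ) : Ordinal.{w}) ↔
    ∃ a ∈ acl n A \ acl n B, RankGE n A ({a} ∪ B) k := by
  rw [← rankGE_succ_iff, Order.succ_eq_add_one, Nat.cast_succ]

theorem RankGE.anti (hM : FinitelyManyTypes L M) {α : Ordinal.{w}} (h : RankGE n A C α) :
    ∀ {B}, B ⊆ aclEq C → RankGE n A B α := by
  induction h with
  | zero C => exact fun _ => .zero _
  | succ C α a ha _ ih =>
    intro B hB
    refine .succ B α a ⟨ha.1, fun h => ha.2 (acl_subset_acl hM hB h)⟩ (ih ?_)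
    exact (subset_aclEq _).trans (aclEq_union_subset hM hB)
  | limit C α hα _ ih => exact fun hB => .limit _ α hα fun β hβ => ih β hβ hB

/-- Each witness lies in `acl n A` and leaves the complement of the closure of the base once it is
adjoined. -/
theorem RankGE.le_ncard (hM : FinitelyManyTypes L M) (hA : A.Finite) {k : ℕ} :
    ∀ {B}, RankGE n A B k → k ≤ (acl n A \ acl n B).ncard := by
  induction k with
  | zero => exact fun _ => Nat.zero_le _
  | succ k ih =>
    intro B h
    obtain ⟨a, ha, h⟩ := rankGE_nat_succ_iff.1 h
    have hfin : (acl n A \ acl n B).Finite := (finite_acl hM n hA).subset Set.sdiff_subset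
    refine (Nat.succ_le_succ (ih h)).trans (Set.ncard_lt_ncard ⟨?_, fun hs => ?_⟩ hfin)
    · exact Set.sdiff_subset_sdiff_right (acl_mono n Set.subset_union_right)
    · exact (hs ha).2 ⟨subset_aclEq _ (Or.inl rfl), ha.1.2⟩

/-- The rank of a finite set, as a natural number. -/
noncomputable def nrk (n : ℕ) (A B : Set (Meq L M)) : ℕ :=
  sSup {k : ℕ | RankGE n A B (k : Ordinal.{w})}

theorem le_nrk_iff (hM : FinitelyManyTypes L M) (hA : A.Finite) {k : ℕ} :
    k ≤ nrk n A B ↔ RankGE n A B (k : Ordinal.{w}) := by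
  have hb : BddAbove {k : ℕ | RankGE n A B (k : Ordinal.{w})} :=
    ⟨_, fun _ h => RankGE.le_ncard hM hA h⟩
  refine ⟨fun h => ?_, fun h => le_csSup hb h⟩
  have : nrk n A B ∈ {k : ℕ | RankGE n A B (k : Ordinal.{w})} :=
    Nat.sSup_mem ⟨0, by simpa using RankGE.zero B⟩ hb
  exact RankGE.of_le this (by exact_mod_cast h)

theorem rank_eq_nrk (hM : FinitelyManyTypes L M) (hA : A.Finite) :
    rank n A B = ((nrk n A B : Ordinal.{w}) : WithTop Ordinal.{w}) := by
  rw [rank_eq_coe_iff]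
  refine ⟨(le_nrk_iff hM hA).1 le_rfl, fun h => ?_⟩
  rw [Order.succ_eq_add_one, ← Nat.cast_succ] at h
  exact absurd ((le_nrk_iff hM hA).2 h) (Nat.not_succ_le_self _)

theorem rank_eq_rank_iff (hM : FinitelyManyTypes L M) (hA : A.Finite) (hA' : A'.Finite) :
    rank n A B = rank n A' B' ↔ nrk n A B = nrk n A' B' := by
  rw [rank_eq_nrk hM hA, rank_eq_nrk hM hA', WithTop.coe_inj, Nat.cast_inj]

theorem rank_eq_one_iff (hM : FinitelyManyTypes L M) (hA : A.Finite) :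
    rank n A B = ((1 : Ordinal.{w}) : WithTop Ordinal.{w}) ↔ nrk n A B = 1 := by
  rw [rank_eq_nrk hM hA, WithTop.coe_inj, Nat.cast_eq_one]

theorem indep_iff (hM : FinitelyManyTypes L M) : Indep n A B C ↔
    ∀ A' ⊆ A, A'.Finite → nrk n A' (B ∪ C) = nrk n A' C :=
  forall₃_congr fun _ _ hA' => rank_eq_rank_iff hM hA' hA'

theorem nrk_anti (hM : FinitelyManyTypes L M) (hA : A.Finite) (h : B ⊆ aclEq C) :
    nrk n A C ≤ nrk n A B :=
  (le_nrk_iff hM hA).2 (RankGE.anti hM ((le_nrk_iff hM hA).1 le_rfl) h)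

theorem nrk_anti' (hM : FinitelyManyTypes L M) (hA : A.Finite) (h : B ⊆ C) :
    nrk n A C ≤ nrk n A B :=
  nrk_anti hM hA (h.trans (subset_aclEq _))

theorem nrk_congr (hM : FinitelyManyTypes L M) (hA : A.Finite) (h : B ⊆ aclEq C)
    (h' : C ⊆ aclEq B) : nrk n A B = nrk n A C :=
  le_antisymm (nrk_anti hM hA h') (nrk_anti hM hA h)

/-- Only the finitely many `a` in `acl n A` can be first witnesses, and each is excluded by a finite
part of `B`: either it is algebraic over that part, or the induction hypothesis applies after
adjoining it. -/
theorem exists_finite_not_rankGE (hM : FinitelyManyTypes L M) (hA : A.Finite) {k : ℕ} :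
    ∀ {B}, ¬ RankGE n A B (k : Ordinal.{w}) → ∃ F ⊆ B, F.Finite ∧ ¬ RankGE n A F k := by
  induction k with
  | zero => exact fun h => absurd (by simpa using RankGE.zero _) h
  | succ k ih =>
    intro B hB
    rw [rankGE_nat_succ_iff] at hB
    push Not at hB
    have key : ∀ a ∈ acl n A, ∃ F ⊆ B, F.Finite ∧ (a ∉ acl n F → ¬ RankGE n A ({a} ∪ F) k) := by
      intro a ha
      by_cases haB : a ∈ acl n B
      · obtain ⟨F, hFB, hF, haF⟩ := exists_finite_of_mem_aclEq hM haB.1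
        exact ⟨F, hFB, hF, fun h => absurd ⟨haF, haB.2⟩ h⟩
      · obtain ⟨F, hFB, hF, h⟩ := ih (hB a ⟨ha, haB⟩)
        -- The induction hypothesis gives a subset of `{a} ∪ B`, from which `a` must be removed.
        refine ⟨F ∩ B, Set.inter_subset_right, hF.subset Set.inter_subset_left, fun _ h' => ?_⟩
        refine h (h'.mono fun x hx => ?_)
        exact (hFB hx).imp id fun h => ⟨hx, h⟩
    choose! F hFB hF h using key
    refine ⟨⋃ a ∈ acl n A, F a, Set.iUnion₂_subset hFB, (finite_acl hM n hA).biUnion hF, ?_⟩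
    rw [rankGE_nat_succ_iff]
    rintro ⟨a, ⟨ha, haF⟩, hr⟩
    have hsub : F a ⊆ ⋃ a ∈ acl n A, F a := Set.subset_biUnion_of_mem (u := F) ha
    exact h a ha (fun h => haF (acl_mono n hsub h))
      (hr.mono (Set.union_subset_union_right _ hsub))

theorem exists_finite_nrk_eq (hM : FinitelyManyTypes L M) (hA : A.Finite) (n : ℕ)
    (B : Set (Meq L M)) : ∃ F ⊆ B, F.Finite ∧ nrk n A F = nrk n A B := by
  obtain ⟨F, hFB, hF, h⟩ := exists_finite_not_rankGE (n := n) (k := nrk n A B + 1) (B := B) hM hA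
    (by rw [← le_nrk_iff hM hA]; exact Nat.not_succ_le_self _)
  rw [← le_nrk_iff hM hA] at h
  exact ⟨F, hFB, hF, le_antisymm (by omega) (nrk_anti' hM hA hFB)⟩

theorem exists_finite_nrk_eq_forall (hM : FinitelyManyTypes L M) (hA : A.Finite) (n : ℕ)
    (B C : Set (Meq L M)) :
    ∃ F ⊆ B, F.Finite ∧ ∀ A' ⊆ A, nrk n A' (F ∪ C) = nrk n A' (B ∪ C) := by
  choose! F hFB hF h using fun A' (hA' : A' ⊆ A) =>
    exists_finite_nrk_eq hM (hA.subset hA') n (B ∪ C)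
  refine ⟨⋃ A' ∈ {A' | A' ⊆ A}, F A' ∩ B, Set.iUnion₂_subset fun _ _ => Set.inter_subset_right,
    hA.finite_subsets.biUnion fun A' hA' => (hF A' hA').subset Set.inter_subset_left,
    fun A' hA' => ?_⟩
  have hfin := hA.subset hA'
  refine le_antisymm ?_ (nrk_anti' hM hfin (Set.union_subset_union_left _
    (Set.iUnion₂_subset fun _ _ => Set.inter_subset_right)))
  rw [← h A' hA']
  refine nrk_anti' hM hfin fun x hx => ?_
  exact (hFB A' hA' hx).imp (fun hB => Set.mem_biUnion (t := fun A' => F A' ∩ B) hA' ⟨hx, hB⟩) id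

/-! ### Invariance of the rank -/

theorem RankGE.of_conj (hM : FinitelyManyTypes L M) {k : ℕ} {ι : Type*} [Finite ι]
    {f g : ι → Meq L M} (h : Conj f g) {S T : Set ι} (hr : RankGE n (f '' S) (f '' T) k) :
    RankGE n (g '' S) (g '' T) k := by
  induction k generalizing ι with
  | zero => simpa using RankGE.zero _
  | succ k ih =>
    obtain ⟨e, ⟨heS, heT⟩, hr⟩ := rankGE_nat_succ_iff.1 hr
    obtain ⟨b, hb⟩ := h.exists_extend hM fun _ : Fin 1 => e
    have himg : ∀ (f : ι → Meq L M) (b : Fin 1 → Meq L M) (S : Set ι),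
        f '' S = Sum.elim f b '' (Sum.inl '' S) := fun f b S => by
      simp [Set.image_image]
    have himg' : ∀ (f : ι → Meq L M) (b : Fin 1 → Meq L M) (S : Set ι),
        {b 0} ∪ f '' S = Sum.elim f b '' ({Sum.inr 0} ∪ Sum.inl '' S) := fun f b S => by
      simp [Set.image_image, Set.image_insert_eq]
    have hmem : ∀ S : Set ι, e ∈ acl n (f '' S) ↔ b 0 ∈ acl n (g '' S) := fun S => by
      rw [himg f (fun _ => e), himg g b]
      exact (eqTp_iff_conj.2 hb).mem_acl_iff hM (i := Sum.inr 0)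
    refine rankGE_nat_succ_iff.2 ⟨b 0, ⟨(hmem S).1 heS, fun h => heT ((hmem T).2 h)⟩, ?_⟩
    rw [himg g b, himg']
    refine ih hb ?_
    rwa [← himg f, ← himg' f]

/-- A finite part of the base computes the rank on the right, which reduces the claim to conjugate
finite tuples. -/
theorem nrk_image_le (hM : FinitelyManyTypes L M) {ι : Type*} {f g : ι → Meq L M} (h : EqTp f g)
    {S T : Set ι} (hS : S.Finite) : nrk n (f '' S) (f '' T) ≤ nrk n (g '' S) (g '' T) := by
  obtain ⟨T₀, hT₀T, hT₀, hr⟩ := Set.exists_subset_image_finite_and.1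
    (exists_finite_nrk_eq hM (hS.image g) n (g '' T))
  rw [← hr]
  refine (nrk_anti' hM (hS.image f) (Set.image_mono hT₀T)).trans ?_
  rw [le_nrk_iff hM (hS.image g)]
  have := (hS.union hT₀).to_subtype
  have himg : ∀ (f : ι → Meq L M) (R : Set ι), R ⊆ S ∪ T₀ →
      f '' R = (f ∘ (Subtype.val : ↥(S ∪ T₀) → ι)) '' (Subtype.val ⁻¹' R) := by
    intro f R hR
    rw [Set.image_comp, Subtype.image_preimage_coe, Set.inter_eq_right.2 hR]
  rw [himg g S Set.subset_union_left, himg g T₀ Set.subset_union_right]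
  refine RankGE.of_conj hM (h.conj Subtype.val) ?_
  rw [← himg f S Set.subset_union_left, ← himg f T₀ Set.subset_union_right]
  exact (le_nrk_iff hM (hS.image f)).1 le_rfl

theorem nrk_image_eq (hM : FinitelyManyTypes L M) {ι : Type*} {f g : ι → Meq L M} (h : EqTp f g)
    {S T : Set ι} (hS : S.Finite) : nrk n (f '' S) (f '' T) = nrk n (g '' S) (g '' T) :=
  le_antisymm (nrk_image_le hM h hS) (nrk_image_le hM h.symm hS)

/-! ### Chains of elements of rank one -/

/-- `RankOneChain n A B k` says that there is a maximal chain of `k` elements of `acl^n(A)`, each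
of them of rank one over the union of `B` and its predecessors. -/
inductive RankOneChain (n : ℕ) (A : Set (Meq L M)) : Set (Meq L M) → ℕ → Prop
  | nil (B : Set (Meq L M)) (h : acl n A ⊆ acl n B) : RankOneChain n A B 0
  | cons (B : Set (Meq L M)) (k : ℕ) (a : Meq L M) (ha : a ∈ acl n A) (h1 : nrk n {a} B = 1)
      (h : RankOneChain n A ({a} ∪ B) k) : RankOneChain n A B (k + 1)

theorem one_le_nrk_singleton_iff (hM : FinitelyManyTypes L M) {a : Meq L M}
    (ha : a ∈ level L M n) : 1 ≤ nrk n {a} B ↔ a ∉ aclEq B := by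
  rw [le_nrk_iff hM (Set.finite_singleton a), ← zero_add 1, rankGE_nat_succ_iff]
  constructor
  · rintro ⟨e, ⟨hea, heB⟩, -⟩ haB
    exact heB (acl_subset_acl hM (Set.singleton_subset_iff.2 haB) hea)
  · exact fun h => ⟨a, ⟨⟨subset_aclEq _ rfl, ha⟩, fun h' => h h'.1⟩, by simpa using RankGE.zero _⟩

/-- A witness `a` after which the rank drops by exactly one must have rank one: otherwise an element
algebraic over `a` could be inserted before it, making the rank of `A` too large. -/
theorem exists_rankOneChain (hM : FinitelyManyTypes L M) (hA : A.Finite) (n : ℕ)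
    (B : Set (Meq L M)) : RankOneChain n A B (nrk n A B) := by
  generalize hk : nrk n A B = k
  induction k generalizing B with
  | zero =>
    refine .nil B fun a ha => ?_
    by_contra haB
    have : 0 + 1 ≤ nrk n A B := (le_nrk_iff hM hA).2
      (rankGE_nat_succ_iff.2 ⟨a, ⟨ha, haB⟩, by simpa using RankGE.zero _⟩)
    omega
  | succ k ih =>
    obtain ⟨a, ⟨haA, haB⟩, hr⟩ := rankGE_nat_succ_iff.1 ((le_nrk_iff hM hA).1 hk.ge)
    have hk' : nrk n A ({a} ∪ B) = k := by
      refine le_antisymm ?_ ((le_nrk_iff hM hA).2 hr)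
      by_contra hc
      have : k + 1 + 1 ≤ nrk n A B := (le_nrk_iff hM hA).2
        (rankGE_nat_succ_iff.2 ⟨a, ⟨haA, haB⟩, (le_nrk_iff hM hA).1 (by omega)⟩)
      omega
    refine .cons B k a haA ?_ (ih _ hk')
    refine le_antisymm ?_ ((one_le_nrk_singleton_iff hM haA.2).2 fun h => haB ⟨h, haA.2⟩)
    by_contra hc
    have hfin := Set.finite_singleton a
    obtain ⟨e, ⟨hea, heB⟩, hr'⟩ := rankGE_nat_succ_iff.1
      ((le_nrk_iff (n := n) (B := B) hM hfin (k := 1 + 1)).1 (by omega))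
    obtain ⟨f, ⟨hfa, hfe⟩, -⟩ := rankGE_nat_succ_iff.1
      (show RankGE n {a} ({e} ∪ B) ((0 + 1 : ℕ) : Ordinal.{w}) from hr')
    have hae : a ∉ acl n ({e} ∪ B) := fun h =>
      hfe (acl_subset_acl hM (Set.singleton_subset_iff.2 h.1) hfa)
    have heA : e ∈ acl n A := acl_subset_acl hM (Set.singleton_subset_iff.2 haA.1) hea
    have : k + 1 + 1 ≤ nrk n A B := by
      refine (le_nrk_iff hM hA).2 (rankGE_nat_succ_iff.2 ⟨e, ⟨heA, heB⟩,
        rankGE_nat_succ_iff.2 ⟨a, ⟨haA, hae⟩, hr.anti hM ?_⟩⟩)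
      refine Set.union_subset ((Set.subset_union_left).trans (subset_aclEq _)) (Set.union_subset ?_
        (Set.subset_union_right.trans (subset_aclEq _)))
      exact Set.singleton_subset_iff.2 (aclEq_mono Set.subset_union_left hea.1)
    omega

theorem RankOneChain.congr (hM : FinitelyManyTypes L M) {k : ℕ} (h : RankOneChain n A B k) :
    ∀ {B'}, B ⊆ aclEq B' → B' ⊆ aclEq B → RankOneChain n A B' k := by
  induction h with
  | nil B h => exact fun hB _ => .nil _ (h.trans (acl_subset_acl hM hB))
  | cons B k a ha h1 _ ih =>
    refine fun hB hB' => .cons _ k a ha ?_ (ih ?_ ?_)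
    · rw [← h1]
      exact nrk_congr hM (Set.finite_singleton a) hB' hB
    · exact (subset_aclEq _).trans (aclEq_union_subset hM hB)
    · exact (subset_aclEq _).trans (aclEq_union_subset hM hB')

theorem RankOneChain.append (hM : FinitelyManyTypes L M) {k l : ℕ} (h : RankOneChain n A' C k)
    (hA : A' ⊆ aclEq A) (hA' : A' ⊆ level L M n) (h' : RankOneChain n A (A' ∪ C) l) :
    RankOneChain n A C (k + l) := by
  induction h with
  | nil C h =>
    rw [zero_add]
    refine h'.congr hM (Set.union_subset (fun a ha => (h (subset_acl hA' ha)).1) (subset_aclEq _)) ?_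
    exact Set.subset_union_right.trans (subset_aclEq _)
  | cons C k a ha h1 _ ih =>
    rw [Nat.add_right_comm]
    refine .cons C _ a (acl_subset_acl hM hA ha) h1 (ih (h'.congr hM ?_ ?_))
    · exact (Set.union_subset_union_right _ Set.subset_union_right).trans (subset_aclEq _)
    · refine Set.union_subset (Set.subset_union_left.trans (subset_aclEq _)) (Set.union_subset ?_
        (Set.subset_union_right.trans (subset_aclEq _)))
      exact Set.singleton_subset_iff.2 (aclEq_mono Set.subset_union_left ha.1)

/-- At the end of the chain `A` is algebraic over the extended base, and so is everything algebraic
over `A ∪ D`; hence the chain is also maximal for `A'`. -/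
theorem RankOneChain.of_subset (hM : FinitelyManyTypes L M) {k : ℕ} (h : RankOneChain n A D k)
    (hA : A ⊆ level L M n) (hAA' : A ⊆ aclEq A') (hA' : A' ⊆ aclEq (A ∪ D)) :
    RankOneChain n A' D k := by
  induction h with
  | nil D h =>
    refine .nil D (acl_subset_acl hM (hA'.trans (aclEq_subset_of_subset hM ?_)))
    exact Set.union_subset (fun a ha => (h (subset_acl hA ha)).1) (subset_aclEq _)
  | cons D k a ha h1 _ ih =>
    refine .cons D k a (acl_subset_acl hM hAA' ha) h1 (ih (hA'.trans (aclEq_mono ?_)))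
    exact Set.union_subset_union_right _ Set.subset_union_right

/-! ### Exchange: uniqueness of chain lengths, additivity and symmetry -/

theorem ExchangeProperty.mem_aclEq {κ : Cardinal.{w}} (hexch : ExchangeProperty L M κ n)
    (hM : FinitelyManyTypes L M) (hB : #B < κ) {c d : Meq L M} (hc : c ∈ level L M n)
    (hd : d ∈ level L M n) (hc1 : nrk n {c} B = 1) (hd1 : nrk n {d} B = 1)
    (h : d ∈ aclEq ({c} ∪ B)) : c ∈ aclEq ({d} ∪ B) := by
  -- Only the case `k = 2` of the exchange property is needed.
  have key := hexch B hB 2 (fun i => if i = 1 then c else d) le_rfl ?_ ?_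
  · simpa using key
  · rintro i ⟨h1, h2⟩
    rw [← rank_eq_one_iff hM (Set.finite_singleton _)] at hc1 hd1
    by_cases hi : i = 1
    · simpa [hi] using ⟨hc, hc1⟩
    · simpa [hi] using ⟨hd, hd1⟩
  · have := (one_le_nrk_singleton_iff hM hd).1 hd1.ge
    have h12 : Set.Ico 1 2 = {1} := by
      ext i
      simp only [Set.mem_Ico, Set.mem_singleton_iff]
      omega
    simpa [h12] using ⟨h, this⟩

theorem mk_union_lt {κ : Cardinal.{w}} (hκ : ℵ₀ ≤ κ) (hA : A.Finite) (hB : #B < κ) :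
    #(A ∪ B : Set (Meq L M)) < κ :=
  (mk_union_le A B).trans_lt (add_lt_of_lt hκ ((lt_aleph0_iff_finite.2 hA.to_subtype).trans_le hκ) hB)

/-- A Jordan-Hölder argument. Let `c` and `d` be the first elements of the two chains. If they are
interalgebraic over `B`, the tails are compared directly. If not, exchange makes neither algebraic
over the other, so both keep rank one; a chain over `{c, d} ∪ B` then completes to one starting with
`c` and one starting with `d`, and each is compared with a given chain by induction. -/
theorem RankOneChain.length_unique {κ : Cardinal.{w}} (hκ : ℵ₀ ≤ κ)
    (hexch : ExchangeProperty L M κ n) (hM : FinitelyManyTypes L M) (hA : A.Finite) {k l : ℕ}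
    (hB : #B < κ) (h : RankOneChain n A B k) (h' : RankOneChain n A B l) : k = l := by
  have hnil : ∀ {B : Set (Meq L M)} {a : Meq L M}, acl n A ⊆ acl n B → a ∈ acl n A →
      nrk n {a} B ≠ 1 := fun hs ha h1 =>
    (one_le_nrk_singleton_iff hM ha.2).1 h1.ge (hs ha).1
  induction k generalizing B l with
  | zero =>
    cases h with
    | nil _ hs =>
      cases h' with
      | nil => rfl
      | cons _ l d hd hd1 _ => exact absurd hd1 (hnil hs hd)
  | succ k ih =>
    cases h with
    | cons _ _ c hc hc1 h =>
      cases h' with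
      | nil _ hs => exact absurd hc1 (hnil hs hc)
      | cons _ l d hd hd1 h' =>
        have hcB := mk_union_lt hκ (Set.finite_singleton c) hB
        have hdB := mk_union_lt hκ (Set.finite_singleton d) hB
        have hiff : c ∈ aclEq ({d} ∪ B) ↔ d ∈ aclEq ({c} ∪ B) :=
          ⟨hexch.mem_aclEq hM hB hd.2 hc.2 hd1 hc1, hexch.mem_aclEq hM hB hc.2 hd.2 hc1 hd1⟩
        rw [Nat.add_right_cancel_iff]
        by_cases hdc : d ∈ aclEq ({c} ∪ B)
        · refine ih hcB h (h'.congr hM ?_ ?_)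
          · exact Set.union_subset (Set.singleton_subset_iff.2 hdc)
              (Set.subset_union_right.trans (subset_aclEq _))
          · exact Set.union_subset (Set.singleton_subset_iff.2 (hiff.2 hdc))
              (Set.subset_union_right.trans (subset_aclEq _))
        · have hcd : c ∉ aclEq ({d} ∪ B) := fun h => hdc (hiff.1 h)
          have hd1' : nrk n {d} ({c} ∪ B) = 1 := le_antisymm
            ((nrk_anti' hM (Set.finite_singleton d) Set.subset_union_right).trans hd1.le)
            ((one_le_nrk_singleton_iff hM hd.2).2 hdc)
          have hc1' : nrk n {c} ({d} ∪ B) = 1 := le_antisymm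
            ((nrk_anti' hM (Set.finite_singleton c) Set.subset_union_right).trans hc1.le)
            ((one_le_nrk_singleton_iff hM hc.2).2 hcd)
          have hf := exists_rankOneChain hM hA n ({c} ∪ ({d} ∪ B))
          have h1 := RankOneChain.cons _ _ c hc hc1' hf
          rw [Set.union_left_comm] at hf
          have h2 := RankOneChain.cons _ _ d hd hd1' hf
          have hk := ih hcB h h2
          rw [Set.union_left_comm] at h1
          rw [← hk] at h1
          exact ih hdB h1 h'

theorem RankOneChain.eq_nrk {κ : Cardinal.{w}} (hκ : ℵ₀ ≤ κ)
    (hexch : ExchangeProperty L M κ n) (hM : FinitelyManyTypes L M) (hA : A.Finite) {k : ℕ}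
    (hB : #B < κ) (h : RankOneChain n A B k) : nrk n A B = k :=
  (exists_rankOneChain hM hA n B).length_unique hκ hexch hM hA hB h

/-- Additivity of the rank. -/
theorem nrk_add {κ : Cardinal.{w}} (hκ : ℵ₀ ≤ κ) (hexch : ExchangeProperty L M κ n)
    (hM : FinitelyManyTypes L M) (hA : A.Finite) (hAn : A ⊆ level L M n) (hA' : A' ⊆ A)
    (hC : #C < κ) : nrk n A C = nrk n A' C + nrk n A (A' ∪ C) :=
  RankOneChain.eq_nrk hκ hexch hM hA hC ((exists_rankOneChain hM (hA.subset hA') n C).append hM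
    (hA'.trans (subset_aclEq _)) (hA'.trans hAn) (exists_rankOneChain hM hA n _))

/-- Although `acl n (A ∪ B)` may be larger than `acl n A`, a maximal chain for `A` over `D ⊇ B` is
maximal for `A ∪ B`; uniqueness of lengths concludes. -/
theorem nrk_union_eq {κ : Cardinal.{w}} (hκ : ℵ₀ ≤ κ) (hexch : ExchangeProperty L M κ n)
    (hM : FinitelyManyTypes L M) (hA : A.Finite) (hB : B.Finite) (hAn : A ⊆ level L M n)
    (hD : #D < κ) (hBD : B ⊆ D) : nrk n (A ∪ B) D = nrk n A D :=
  RankOneChain.eq_nrk hκ hexch hM (hA.union hB) hD ((exists_rankOneChain hM hA n D).of_subset hM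
    hAn (Set.subset_union_left.trans (subset_aclEq _))
    ((Set.union_subset_union_right _ hBD).trans (subset_aclEq _)))

/-- The rank of `A` is the sum of the ranks of `A'` and of `A` over `A'`. Neither summand grows with
the base, so if the sum is unchanged then both are. -/
theorem indep_iff_nrk_eq {κ : Cardinal.{w}} (hκ : ℵ₀ ≤ κ) (hexch : ExchangeProperty L M κ n)
    (hM : FinitelyManyTypes L M) (hA : A.Finite) (hAn : A ⊆ level L M n)
    (hBC : #(B ∪ C : Set (Meq L M)) < κ) :
    Indep n A B C ↔ nrk n A (B ∪ C) = nrk n A C := by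
  rw [indep_iff hM]
  refine ⟨fun h => h A subset_rfl hA, fun h A' hA' hf => ?_⟩
  have hC : #C < κ := (mk_le_mk_of_subset Set.subset_union_right).trans_lt hBC
  have h1 := nrk_add hκ hexch hM hA hAn hA' hBC
  have h2 := nrk_add hκ hexch hM hA hAn hA' hC
  have h3 := nrk_anti' (n := n) hM hf (Set.subset_union_right : C ⊆ B ∪ C)
  have h4 := nrk_anti' (n := n) hM hA
    (Set.union_subset_union_right A' (Set.subset_union_right : C ⊆ B ∪ C))
  omega

theorem nrk_union_add {κ : Cardinal.{w}} (hκ : ℵ₀ ≤ κ) (hexch : ExchangeProperty L M κ n)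
    (hM : FinitelyManyTypes L M) (hA : A.Finite) (hB : B.Finite) (hAn : A ⊆ level L M n)
    (hBn : B ⊆ level L M n) (hC : #C < κ) : nrk n (A ∪ B) C = nrk n B C + nrk n A (B ∪ C) := by
  rw [nrk_add hκ hexch hM (hA.union hB) (Set.union_subset hAn hBn) Set.subset_union_right hC,
    nrk_union_eq hκ hexch hM hA hB hAn (mk_union_lt hκ hB hC) Set.subset_union_left]

/-- The rank of `A ∪ B` over `C` is computed by adjoining `B` first or `A` first. -/
theorem indep_symm_iff {κ : Cardinal.{w}} (hκ : ℵ₀ ≤ κ) (hexch : ExchangeProperty L M κ n)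
    (hM : FinitelyManyTypes L M) (hA : A.Finite) (hB : B.Finite) (hAn : A ⊆ level L M n)
    (hBn : B ⊆ level L M n) (hC : #C < κ) : Indep n A B C ↔ Indep n B A C := by
  rw [indep_iff_nrk_eq hκ hexch hM hA hAn (mk_union_lt hκ hB hC),
    indep_iff_nrk_eq hκ hexch hM hB hBn (mk_union_lt hκ hA hC)]
  have h1 := nrk_union_add hκ hexch hM hA hB hAn hBn hC
  have h2 := nrk_union_add hκ hexch hM hB hA hBn hAn hC
  rw [Set.union_comm] at h2
  omega

end Rank

/-! ### Saturation of `M^eq` -/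

section Extension

variable {L : FirstOrder.Language.{u, v}} {M : Type w} [L.Structure M] {n : ℕ} {α β γ : Type*}

theorem mk_iUnion_range_lt {κ : Cardinal.{w}} (hκ : ℵ₀ ≤ κ) {ι : Type w} (hι : #ι < κ)
    {m : ι → ℕ} (t : ∀ i, Fin (m i) → M) : #(⋃ i, Set.range (t i) : Set M) < κ := by
  rcases finite_or_infinite ι with h | h
  · exact (lt_aleph0_iff_finite.2 (Set.finite_iUnion fun i => Set.finite_range (t i)).to_subtype).trans_le hκ
  · refine (mk_iUnion_le _).trans_lt ((mul_le_mul_right (ciSup_le' fun i => ?_) _).trans_lt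
      ((mul_aleph0_eq (infinite_iff.1 h)).trans_lt hι))
    exact mk_le_aleph0_iff.2 (Set.countable_range (t i)).to_subtype

/-- Imaginary variables and parameters are replaced by real tuples representing them, and saturation
of `M` applies. The solutions in `hfip` are required to be conjugate to `x₀` so that one system of
codes presents them all. -/
theorem IsSaturated.exists_mem_eq {κ : Cardinal.{w}} (hκ : ℵ₀ ≤ κ) (hsat : IsSaturated L M κ)
    (hM : FinitelyManyTypes L M) [Finite γ] {P : Set (Meq L M)} (hP : #P < κ) {ι : Type*}
    (X : ι → Set (γ → Meq L M)) (x₀ : γ → Meq L M)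
    (hX : ∀ i, ∃ F ⊆ P, F.Finite ∧ ∀ x x' : γ → Meq L M,
      Conj (Sum.elim x (Subtype.val : F → Meq L M)) (Sum.elim x' Subtype.val) → x ∈ X i → x' ∈ X i)
    (hfip : ∀ s : Finset ι, ∃ x, Conj x₀ x ∧ ∀ i ∈ s, x ∈ X i) : ∃ x, ∀ i, x ∈ X i := by
  obtain ⟨m, r₀, c, rfl⟩ := exists_codes x₀
  choose l t d ht using fun p : P => exists_code p.1
  obtain ⟨r, hr⟩ := hsat.exists_mem hκ (A := ⋃ p, Set.range (t p))
    (mk_iUnion_range_lt hκ hP t) (fun i => {r : Fin m → M | (fun j => (c j).eval r) ∈ X i})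
    (fun i => by
      obtain ⟨F, hFP, hF, hinv⟩ := hX i
      have := hF.to_subtype
      let p : F → P := fun f => ⟨f.1, hFP f.2⟩
      let s : (Σ f : F, Fin (l (p f))) → M := fun j => t (p j.1) j.2
      -- The condition is definable merely because it is invariant under equality of types.
      have h1 : (∅ : Set M).Definable L {z : Fin m ⊕ (Σ f : F, Fin (l (p f))) → M |
          ∃ r : Fin m → M, SameType L (Sum.elim r s) z ∧ (fun j => (c j).eval r) ∈ X i} :=
        hM.definable_of_invariant fun x y hxy ⟨r, hr, hrX⟩ => ⟨r, hr.trans hxy, hrX⟩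
      have h2 := Set.definable_iInter_of_finite fun j => definable_coord_eq (L := L)
        (A := ⋃ p, Set.range (t p)) (a := s j) (Set.mem_iUnion_of_mem (p j.1) ⟨j.2, rfl⟩)
        (Sum.inr j : Fin m ⊕ (Σ f : F, Fin (l (p f))))
      convert! ((h1.mono (Set.empty_subset _)).inter h2).exists_of_finite using 1
      ext r
      constructor
      · intro h
        refine ⟨s, ⟨r, .refl _, h⟩, ?_⟩
        simp only [Set.mem_iInter]
        exact fun _ => rfl
      · rintro ⟨u, ⟨r', hr', h⟩, hu⟩
        simp only [Set.mem_iInter] at hu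
        obtain rfl : u = s := funext hu
        refine hinv _ _ ?_ h
        have := Conj.of_codes hr' (Sum.elim (fun j => (c j).map Sum.inl)
          (fun f => (d (p f)).map fun j => Sum.inr ⟨f, j⟩) : γ ⊕ F → _)
        have hs : ∀ f : F, f.1 = (d (p f)).eval (fun j => s ⟨f, j⟩) := fun f => ht (p f)
        convert! this using 1 <;>
        · funext j
          rcases j with j | j
          · simp
          · simpa [Function.comp_def] using hs j) (fun s => by
      obtain ⟨x, hx, hxs⟩ := hfip s
      obtain ⟨r, -, rfl⟩ := hx.symm.exists_representative hM
      exact ⟨r, hxs⟩)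
  exact ⟨_, hr⟩

theorem eqTp_of_finite {a a' : α → Meq L M} {C : Set (Meq L M)}
    (h : ∀ F ⊆ C, F.Finite →
      Conj (Sum.elim a (Subtype.val : F → Meq L M)) (Sum.elim a' Subtype.val)) :
    EqTp (Sum.elim a (Subtype.val : C → Meq L M)) (Sum.elim a' Subtype.val) := by
  intro m j
  let F : Set (Meq L M) := Subtype.val '' ((Sum.inr : C → α ⊕ C) ⁻¹' Set.range j)
  have hF : F.Finite := ((Set.finite_range j).preimage Sum.inr_injective.injOn).image _
  have hFC : F ⊆ C := by
    rintro _ ⟨c, -, rfl⟩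
    exact c.2
  have key : ∀ i, ∃ z : α ⊕ F, ∀ b : α → Meq L M,
      Sum.elim b (Subtype.val : F → Meq L M) z = Sum.elim b (Subtype.val : C → Meq L M) (j i) := by
    intro i
    rcases hj : j i with x | c
    · exact ⟨Sum.inl x, fun _ => rfl⟩
    · exact ⟨Sum.inr ⟨c.1, c, ⟨i, hj⟩, rfl⟩, fun _ => rfl⟩
  choose z hz using key
  have := (h F hFC hF).comp z
  rwa [show Sum.elim a (Subtype.val : F → Meq L M) ∘ z = _ from funext fun i => hz i a,
    show Sum.elim a' (Subtype.val : F → Meq L M) ∘ z = _ from funext fun i => hz i a'] at this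

theorem EqTp.conj_finite [Finite α] {a a' : α → Meq L M} {C F : Set (Meq L M)}
    (h : EqTp (Sum.elim a (Subtype.val : C → Meq L M)) (Sum.elim a' Subtype.val))
    (hFC : F ⊆ C) (hF : F.Finite) :
    Conj (Sum.elim a (Subtype.val : F → Meq L M)) (Sum.elim a' Subtype.val) := by
  have := hF.to_subtype
  have h' := h.conj (Sum.map id (Set.inclusion hFC))
  rwa [Sum.elim_comp_map, Sum.elim_comp_map] at h'

theorem conj_elim_rotate {δ : Type*} {u u' : α → Meq L M} {v v' : γ → Meq L M} {g g' : δ → Meq L M} :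
    Conj (Sum.elim v (Sum.elim u g)) (Sum.elim v' (Sum.elim u' g')) ↔
      Conj (Sum.elim (Sum.elim u v) g) (Sum.elim (Sum.elim u' v') g') := by
  constructor
  · intro h
    have := h.comp (Sum.elim (Sum.elim (Sum.inr ∘ Sum.inl) Sum.inl) (Sum.inr ∘ Sum.inr) :
      (α ⊕ γ) ⊕ δ → γ ⊕ (α ⊕ δ))
    convert this using 1 <;>
    · funext i
      rcases i with (i | i) | i <;> rfl
  · intro h
    have := h.comp (Sum.elim (Sum.inl ∘ Sum.inr) (Sum.map Sum.inl id) :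
      γ ⊕ (α ⊕ δ) → (α ⊕ γ) ⊕ δ)
    convert this using 1 <;>
    · funext i
      rcases i with i | i | i <;> rfl

/-- The common saturation argument: `Z` is an extra constraint on the new tuple, imposed for every
finite part `F` of `B`, while the type is prescribed only over `F ∩ C`. -/
theorem IsSaturated.exists_eqTp_extend {κ : Cardinal.{w}} (hκ : ℵ₀ ≤ κ) (hsat : IsSaturated L M κ)
    (hM : FinitelyManyTypes L M) [Finite α] [Finite γ] {B C : Set (Meq L M)} (hB : #B < κ)
    (hCB : C ⊆ B) {u u' : α → Meq L M} (v : γ → Meq L M) (Z : Set (Meq L M) → Set (γ → Meq L M))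
    (hZ : ∀ F G, F ⊆ G → Z G ⊆ Z F)
    (hZinv : ∀ F : Set (Meq L M), F.Finite → ∀ x x' : γ → Meq L M,
      Conj (Sum.elim x (Subtype.val : ↥(Set.range u' ∪ F) → Meq L M))
        (Sum.elim x' Subtype.val) → x ∈ Z F → x' ∈ Z F)
    (hne : ∀ F ⊆ B, F.Finite → ∃ v' ∈ Z F,
      Conj (Sum.elim (Sum.elim u v) (Subtype.val : ↥(F ∩ C) → Meq L M))
        (Sum.elim (Sum.elim u' v') Subtype.val)) :
    ∃ v', EqTp (Sum.elim (Sum.elim u v) (Subtype.val : C → Meq L M))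
      (Sum.elim (Sum.elim u' v') Subtype.val) ∧ ∀ F ⊆ B, F.Finite → v' ∈ Z F := by
  obtain ⟨v', hv'⟩ := hsat.exists_mem_eq hκ hM (γ := γ) (P := Set.range u' ∪ B)
    (mk_union_lt hκ (Set.finite_range u') hB) (ι := {F : Set (Meq L M) // F ⊆ B ∧ F.Finite})
    (fun F => {v' | v' ∈ Z F.1 ∧
      Conj (Sum.elim (Sum.elim u v) (Subtype.val : ↥(F.1 ∩ C) → Meq L M))
        (Sum.elim (Sum.elim u' v') Subtype.val)}) v
    (by
      rintro ⟨F, hFB, hF⟩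
      refine ⟨Set.range u' ∪ F, Set.union_subset_union_right _ hFB, (Set.finite_range u').union hF,
        fun x x' hxx' hx => ⟨hZinv F hF x x' hxx' hx.1, hx.2.trans hM ?_⟩⟩
      have := hxx'.comp (Sum.elim
        (Sum.elim (fun i => Sum.inr ⟨u' i, Or.inl ⟨i, rfl⟩⟩) Sum.inl)
        (fun f => Sum.inr ⟨f.1, Or.inr f.2.1⟩) :
        (α ⊕ γ) ⊕ ↥(F ∩ C) → γ ⊕ ↥(Set.range u' ∪ F))
      convert this using 1 <;>
      · funext i
        rcases i with (i | i) | i <;> rfl)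
    (by
      intro s
      obtain ⟨v', hv', hc⟩ := hne (⋃ F ∈ s, F.1) (Set.iUnion₂_subset fun F _ => F.2.1)
        (s.finite_toSet.biUnion fun F _ => F.2.2)
      refine ⟨v', ?_, fun F hF => ?_⟩
      · have := hc.comp (Sum.inl ∘ Sum.inr)
        exact this
      · have hsub : F.1 ⊆ ⋃ F ∈ s, F.1 := Set.subset_biUnion_of_mem (u := Subtype.val) hF
        refine ⟨hZ _ _ hsub hv', ?_⟩
        have := hc.comp (Sum.map id (Set.inclusion (Set.inter_subset_inter_left C hsub)))
        rwa [Sum.elim_comp_map, Sum.elim_comp_map] at this)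
  refine ⟨v', eqTp_of_finite fun F hFC hF => ?_, fun F hFB hF => (hv' ⟨F, hFB, hF⟩).1⟩
  have := (hv' ⟨F, hFC.trans hCB, hF⟩).2
  dsimp only at this
  rwa [Set.inter_eq_left.2 hFC] at this

theorem IsSaturated.exists_eqTp {κ : Cardinal.{w}} (hκ : ℵ₀ ≤ κ) (hsat : IsSaturated L M κ)
    (hM : FinitelyManyTypes L M) [Finite α] [Finite γ] {C : Set (Meq L M)} (hC : #C < κ)
    {u u' : α → Meq L M}
    (h : EqTp (Sum.elim u (Subtype.val : C → Meq L M)) (Sum.elim u' Subtype.val))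
    (v : γ → Meq L M) :
    ∃ v', EqTp (Sum.elim (Sum.elim u v) (Subtype.val : C → Meq L M))
      (Sum.elim (Sum.elim u' v') Subtype.val) := by
  obtain ⟨v', hv', -⟩ := hsat.exists_eqTp_extend hκ hM hC subset_rfl (u := u) (u' := u') v (fun _ => Set.univ)
    (fun _ _ _ => subset_rfl) (fun _ _ _ _ _ _ => trivial) (fun F hFC hF => by
      have hf : (F ∩ C).Finite := hF.subset Set.inter_subset_left
      have := hf.to_subtype
      obtain ⟨v', hv'⟩ := (h.conj_finite Set.inter_subset_right hf).exists_extend hM v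
      refine ⟨v', trivial, conj_elim_rotate.1 ?_⟩
      have := hv'.comp Sum.swap
      rwa [Sum.elim_swap, Sum.elim_swap] at this)
  exact ⟨v', hv'⟩

theorem IsSaturated.exists_eqTp_notMem_aclEq {κ : Cardinal.{w}} (hκ : ℵ₀ ≤ κ)
    (hsat : IsSaturated L M κ) (hM : FinitelyManyTypes L M) [Finite α] {B C : Set (Meq L M)}
    (hB : #B < κ) (hCB : C ⊆ B) {u u' : α → Meq L M}
    (h : EqTp (Sum.elim u (Subtype.val : C → Meq L M)) (Sum.elim u' Subtype.val))
    {v : Meq L M} (hvn : v ∈ level L M n) (hv : v ∉ aclEq (Set.range u ∪ C)) :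
    ∃ v', EqTp (Sum.elim (Sum.elim u fun _ : Fin 1 => v) (Subtype.val : C → Meq L M))
      (Sum.elim (Sum.elim u' fun _ => v') Subtype.val) ∧ v' ∉ aclEq (Set.range u' ∪ B) := by
  obtain ⟨v', hv', hacl⟩ := hsat.exists_eqTp_extend hκ hM hB hCB (u := u) (u' := u')
    (fun _ : Fin 1 => v) (fun F => {x | x 0 ∉ aclEq (Set.range u' ∪ F)})
    (fun F G hFG x hx hxF => hx (aclEq_mono (Set.union_subset_union_right _ hFG) hxF))
    (fun F hF x x' hxx' hx hx' => hx (by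
      have hfin : (Set.range u' ∪ F).Finite := (Set.finite_range u').union hF
      have := hfin.to_subtype
      have h1 := (eqTp_iff_conj.2 hxx'.symm).mem_aclEq hM (i := Sum.inl 0) (S := Set.range Sum.inr)
      rw [← Set.range_comp, ← Set.range_comp, Sum.elim_comp_inr, Sum.elim_comp_inr,
        Subtype.range_val] at h1
      exact h1 hx')) (fun F hFB hF => by
      have hf : (F ∩ C).Finite := hF.subset Set.inter_subset_left
      have := hf.to_subtype
      obtain ⟨x, hx⟩ := (h.conj_finite Set.inter_subset_right hf).exists_extend hM
        (fun _ : Fin 1 => v)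
      replace hx := hx.comp Sum.swap
      rw [Sum.elim_swap, Sum.elim_swap, show x = fun _ => x 0 from funext fun i => by
        rw [Subsingleton.elim i 0] ] at hx
      have hinf : ¬ (orbit (Sum.elim u' (Subtype.val : ↥(F ∩ C) → Meq L M)) (x 0)).Finite := by
        intro hfin
        refine hv (aclEq_mono ?_ ((mem_aclEq_range_iff hM).2
          (finite_orbit_of_conj hM hx.symm hfin)))
        rw [Set.Sum.elim_range, Subtype.range_val]
        exact Set.union_subset_union_right _ Set.inter_subset_right
      -- The conjugates form an infinite set, while `acl n` of a finite set is finite, so some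
      -- conjugate avoids it.
      obtain ⟨y, hy, hyacl⟩ := (Set.Infinite.sdiff hinf
        (finite_acl hM n ((Set.finite_range u').union hF))).nonempty
      have hvy := hx.trans hM hy
      exact ⟨fun _ => y, fun hyF => hyacl ⟨hyF, hvy.mem_level (i := Sum.inl 0) hvn⟩,
        conj_elim_rotate.1 hvy⟩)
  refine ⟨v' 0, ?_, fun h0 => ?_⟩
  · rwa [show v' = fun _ => v' 0 from funext fun i => by rw [Subsingleton.elim i 0] ] at hv'
  · obtain ⟨G, hG, hGf, hvG⟩ := exists_finite_of_mem_aclEq hM h0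
    refine hacl (G ∩ B) Set.inter_subset_right (hGf.subset Set.inter_subset_left)
      (aclEq_mono ?_ hvG)
    exact fun x hx => (hG hx).imp id fun hB => ⟨hx, hB⟩

/-- The tuple `t` collects the witnesses of the rank met so far and `t'` their copies. Each new
witness is copied outside the closure of `t'` and `B`; `a` is copied only when all witnesses are in
place, so that it has the same relation to them. -/
theorem IsSaturated.exists_eqTp_rankGE {κ : Cardinal.{w}} (hκ : ℵ₀ ≤ κ)
    (hsat : IsSaturated L M κ) (hM : FinitelyManyTypes L M) [Finite α] [Finite γ]
    {B C : Set (Meq L M)} (hB : #B < κ) (hCB : C ⊆ B) {t t' : α → Meq L M}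
    (h : EqTp (Sum.elim t (Subtype.val : C → Meq L M)) (Sum.elim t' Subtype.val))
    (a : γ → Meq L M) {k : ℕ} (hr : RankGE n (Set.range a) (Set.range t ∪ C) k) :
    ∃ a', EqTp (Sum.elim (Sum.elim t a) (Subtype.val : C → Meq L M))
      (Sum.elim (Sum.elim t' a') Subtype.val) ∧
      RankGE n (Set.range a') (Set.range t' ∪ B) k := by
  induction k generalizing α with
  | zero =>
    obtain ⟨a', ha'⟩ := hsat.exists_eqTp hκ hM ((mk_le_mk_of_subset hCB).trans_lt hB) h a
    exact ⟨a', ha', by simpa using RankGE.zero _⟩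
  | succ k ih =>
    obtain ⟨e, ⟨hea, het⟩, hr⟩ := rankGE_nat_succ_iff.1 hr
    obtain ⟨e', he', he'B⟩ := hsat.exists_eqTp_notMem_aclEq hκ hM hB hCB h hea.2
      (fun h => het ⟨h, hea.2⟩)
    have hrange : ∀ (t : α → Meq L M) (e : Meq L M) (C : Set (Meq L M)),
        Set.range (Sum.elim t fun _ : Fin 1 => e) ∪ C = {e} ∪ (Set.range t ∪ C) := by
      intro t e C
      rw [Set.Sum.elim_range, Set.range_const, Set.union_comm (Set.range t), Set.union_assoc]
    obtain ⟨a', ha', hr'⟩ := ih he' (by rwa [hrange])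
    rw [hrange] at hr'
    refine ⟨a', ?_, rankGE_nat_succ_iff.2 ⟨e', ⟨?_, fun h => he'B h.1⟩, hr'⟩⟩
    · have := ha'.comp (Sum.map (Sum.map Sum.inl id) id)
      rwa [Sum.elim_comp_map, Sum.elim_comp_map, Sum.elim_comp_map, Sum.elim_comp_map] at this
    · have := ha'.mem_acl_iff hM (n := n) (i := Sum.inl (Sum.inl (Sum.inr 0)))
        (S := Set.range (Sum.inl ∘ Sum.inr))
      rw [← Set.range_comp, ← Set.range_comp] at this
      exact this.1 hea

theorem tp_eq_of_eqTp (hM : FinitelyManyTypes L M) {C : Set (Meq L M)} {m : ℕ}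
    {a a' : Fin m → Meq L M}
    (h : EqTp (Sum.elim a (Subtype.val : C → Meq L M)) (Sum.elim a' Subtype.val)) :
    tp C a = tp C a' := by
  ext φ
  obtain ⟨F, hFC, hF, hinv⟩ := exists_finite_support hM (A := C) ⟨φ, rfl⟩
  have := h.conj_finite hFC hF
  exact ⟨hinv _ _ this, hinv _ _ this.symm⟩

/-- The conjugacy class of a finite tuple is defined by a formula without parameters, so equal types
imply conjugacy. -/
theorem IsElementaryOn.eqTp (hM : FinitelyManyTypes L M) {σ : Meq L M → Meq L M}
    {D : Set (Meq L M)} (hσ : IsElementaryOn σ D) :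
    EqTp (Subtype.val : D → Meq L M) (σ ∘ Subtype.val) := by
  intro m j
  obtain ⟨φ, hφ⟩ := definable_conj hM (Subtype.val ∘ j)
  have h1 : φ ∈ tp ∅ (Subtype.val ∘ j) := (Set.ext_iff.1 hφ _).1 (Conj.refl _)
  have h2 := hσ.2 m (Subtype.val ∘ j) fun i => (j i).2
  rw [h2] at h1
  exact (Set.ext_iff.1 hφ _).2 h1

theorem IsElementaryOn.nrk_image (hM : FinitelyManyTypes L M) {σ : Meq L M → Meq L M}
    {A B D : Set (Meq L M)} (hσ : IsElementaryOn σ D) (hAf : A.Finite) (hA : A ⊆ D) (hB : B ⊆ D) :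
    nrk n (σ '' A) (σ '' B) = nrk n A B := by
  have := nrk_image_eq (n := n) hM (hσ.eqTp hM) (S := Subtype.val ⁻¹' A) (T := Subtype.val ⁻¹' B)
    (hAf.preimage Subtype.val_injective.injOn)
  rw [Set.image_comp, Set.image_comp, Subtype.image_preimage_coe, Subtype.image_preimage_coe,
    Set.inter_eq_right.2 hA, Set.inter_eq_right.2 hB] at this
  exact this.symm

end Extension

/-! ### The axioms of an independence relation -/

section Independence

variable {L : FirstOrder.Language.{u, v}} {M : Type w} [L.Structure M] {n : ℕ}
  {A B C D : Set (Meq L M)}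

theorem IsElementaryOn.indep_image_iff (hM : FinitelyManyTypes L M) {σ : Meq L M → Meq L M}
    (hσ : IsElementaryOn σ D) (h : A ∪ B ∪ C ⊆ D) :
    Indep n A B C ↔ Indep n (σ '' A) (σ '' B) (σ '' C) := by
  obtain ⟨⟨hA, hB⟩, hC⟩ : (A ⊆ D ∧ B ⊆ D) ∧ C ⊆ D := by simpa using h
  rw [indep_iff hM, indep_iff hM]
  have key : ∀ A' ⊆ A, A'.Finite → (nrk n (σ '' A') (σ '' B ∪ σ '' C) = nrk n (σ '' A') (σ '' C) ↔
      nrk n A' (B ∪ C) = nrk n A' C) := by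
    intro A' hA' hf
    rw [← Set.image_union, hσ.nrk_image hM hf (hA'.trans hA) (Set.union_subset hB hC),
      hσ.nrk_image hM hf (hA'.trans hA) hC]
  constructor
  · intro h A' hA' hf
    obtain ⟨A₀, hA₀, hA₀f, rfl⟩ := Set.exists_subset_image_finite_and.1 ⟨A', hA', hf, rfl⟩
    exact (key A₀ hA₀ hA₀f).2 (h A₀ hA₀ hA₀f)
  · exact fun h A' hA' hf => (key A' hA' hf).1 (h _ (Set.image_mono hA') (hf.image σ))

theorem exists_countable_indep (hM : FinitelyManyTypes L M) (hA : A.Finite) (n : ℕ)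
    (B : Set (Meq L M)) : ∃ C ⊆ B, C.Countable ∧ Indep n A B C := by
  obtain ⟨F, hFB, hF, h⟩ := exists_finite_nrk_eq_forall hM hA n B ∅
  refine ⟨F, hFB, hF.countable, (indep_iff hM).2 fun A' hA' _ => ?_⟩
  rw [Set.union_eq_self_of_subset_right hFB]
  simpa using (h A' hA').symm

theorem indep_iff_forall_finite (hM : FinitelyManyTypes L M) (hA : A.Finite) :
    Indep n A B C ↔ ∀ B' ⊆ B, B'.Finite → Indep n A B' C := by
  simp only [indep_iff hM]
  constructor
  · intro h B' hB' _ A' hA' hf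
    refine le_antisymm (nrk_anti' hM hf Set.subset_union_right) ?_
    rw [← h A' hA' hf]
    exact nrk_anti' hM hf (Set.union_subset_union_left _ hB')
  · intro h A' hA' hf
    obtain ⟨F, hFB, hF, hr⟩ := exists_finite_nrk_eq_forall hM hA n B C
    rw [← hr A' hA', h F hFB hF A' hA' hf]

theorem exists_indep_extension {κ : Cardinal.{w}} (hκ : ℵ₀ ≤ κ) (hsat : IsSaturated L M κ)
    (hexch : ExchangeProperty L M κ n) (hM : FinitelyManyTypes L M) {m : ℕ}
    (a : Fin m → Meq L M) (ha : ∀ i, a i ∈ level L M n) (hB : #B < κ) (hCB : C ⊆ B) :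
    ∃ a' : Fin m → Meq L M, tp C a' = tp C a ∧ Indep n (Set.range a') B C := by
  -- The list of witnesses starts empty, and `k` is the full rank of `a` over `C`, which `a'` then
  -- retains over `B`.
  obtain ⟨a', ha', hr⟩ := hsat.exists_eqTp_rankGE (n := n) hκ hM hB hCB
    (t := (Fin.elim0 : Fin 0 → Meq L M)) (EqTp.refl _) a (k := nrk n (Set.range a) C) (by
      rw [Set.range_eq_empty (Fin.elim0 : Fin 0 → Meq L M), Set.empty_union, ← le_nrk_iff hM (Set.finite_range a)])
  replace ha' := ha'.comp (Sum.map Sum.inr id)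
  rw [Sum.elim_comp_map, Sum.elim_comp_map, Sum.elim_comp_inr, Sum.elim_comp_inr] at ha'
  change EqTp (Sum.elim a Subtype.val) (Sum.elim a' Subtype.val) at ha'
  refine ⟨a', (tp_eq_of_eqTp hM ha').symm, ?_⟩
  have hfin := Set.finite_range a'
  have hn : Set.range a' ⊆ level L M n := by
    rintro _ ⟨i, rfl⟩
    exact ha'.mem_level (i := Sum.inl i) (ha i)
  have hBC : B ∪ C = B := Set.union_eq_self_of_subset_right hCB
  rw [indep_iff_nrk_eq hκ hexch hM hfin hn (by rwa [hBC]), hBC]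
  refine le_antisymm (nrk_anti' hM hfin hCB) ?_
  rw [Set.range_eq_empty (Fin.elim0 : Fin 0 → Meq L M), Set.empty_union, ← le_nrk_iff hM hfin] at hr
  refine le_trans (le_of_eq ?_) hr
  have := nrk_image_eq (n := n) hM ha'.symm (S := Set.range Sum.inl) (T := Set.range Sum.inr)
    (Set.finite_range _)
  simpa only [← Set.range_comp, Sum.elim_comp_inl, Sum.elim_comp_inr, Subtype.range_val] using this

theorem Indep.monotone (hM : FinitelyManyTypes L M) (hBC : B ⊆ C) (hCD : C ⊆ D)
    (h : Indep n A D B) : Indep n A C B ∧ Indep n A D C := by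
  simp only [indep_iff hM, Set.union_eq_self_of_subset_right hBC,
    Set.union_eq_self_of_subset_right hCD,
    Set.union_eq_self_of_subset_right (hBC.trans hCD)] at h ⊢
  have key : ∀ A' ⊆ A, A'.Finite → nrk n A' C = nrk n A' B := fun A' hA' hf =>
    le_antisymm (nrk_anti' hM hf hBC) ((h A' hA' hf).symm.le.trans (nrk_anti' hM hf hCD))
  exact ⟨key, fun A' hA' hf => (h A' hA' hf).trans (key A' hA' hf).symm⟩

theorem Indep.transitive (hM : FinitelyManyTypes L M) (hBC : B ⊆ C) (hCD : C ⊆ D)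
    (h : Indep n A C B) (h' : Indep n A D C) : Indep n A D B := by
  simp only [indep_iff hM, Set.union_eq_self_of_subset_right hBC,
    Set.union_eq_self_of_subset_right hCD,
    Set.union_eq_self_of_subset_right (hBC.trans hCD)] at h h' ⊢
  exact fun A' hA' hf => (h' A' hA' hf).trans (h A' hA' hf)

end Independence

end NIndep

theorem mainTheorem1 (L : FirstOrder.Language.{u, v}) (hL : L.card ≤ ℵ₀) (T : L.Theory)
    (hT : T.IsComplete) (hcat : Cardinal.Categorical (ℵ₀ : Cardinal.{w}) T)
    (M : Type w) [L.Structure M] [Nonempty M] [T.Model M]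
    (κ : Cardinal.{w}) (hκ : ℵ₀ ≤ κ) (hsat : NIndep.IsSaturated L M κ)
    (n : ℕ) (hexch : NIndep.ExchangeProperty L M κ n) :
    NIndep.IsIndependenceRelationOn κ (NIndep.level L M n) (NIndep.Indep n) := by
  have hM := NIndep.finitelyManyTypes hL T hcat hκ hsat
  exact
    { invariance := fun _ _ _ _ _ _ _ _ _ _ _ hD hσ => hσ.indep_image_iff hM hD
      local_character := fun _ B hA _ _ _ => NIndep.exists_countable_indep hM hA n B
      finite_character := fun _ _ _ hA _ _ _ _ _ => NIndep.indep_iff_forall_finite hM hA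
      extension := fun _ a _ _ hB ha _ hCB =>
        NIndep.exists_indep_extension hκ hsat hexch hM a ha hB hCB
      monotonicity := fun _ _ _ _ _ _ _ _ hBC hCD h => h.monotone hM hBC hCD
      transitivity := fun _ _ _ _ _ _ _ _ hBC hCD h h' => h.transitive hM hBC hCD h'
      symmetry := fun _ _ _ hA hB hC hAn hBn _ =>
        NIndep.indep_symm_iff hκ hexch hM hA hB hAn hBn hC }
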